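/- Let $W$ be an almost surely positive random variable and let $k\ge 3$ be a fixed integer such that $$\mathbb P(W>x)=o(x^{-2k-1})\qquad\text{as }x\to+\infty .$$ For each $n$ let $W_1,\dots,W_n$ be i.i.d. random variables distributed as $W$, put $L_n=W_1+\dots+W_n$, and let $G_n$ be the generalized random graph on the vertex set $\{1,\dots,n\}$ with these weights: conditionally on $W_1,\dots,W_n$, each pair $i\ne j$ is joined by an edge independently of the other pairs, with probability $$p_{ij}=\frac{W_iW_j}{L_n+W_iW_j},$$ and there are no loops. Let $S_n(k)$ be the number of cycles of length $k$ in $G_n$, where a cycle is a closed walk $v_0,v_1,\dots,v_{k-1},v_0$ with distinct vertices $v_0,\dots,v_{k-1}$, and walks that differ only in the starting point or the orientation are the same cycle. Let $Z_k$ be a Poisson random variable with mean $$\lambda(k)=\frac1{2k}\left(\frac{\mathbb E W^2}{\mathbb E W}\right)^k .$$ Then $$\|\mathcal L(S_n(k))-\mathcal L(Z_k)\|=O(n^{-1/2})\qquad\text{as }n\to\infty ,$$ where the total variation distance of the laws of two random variables $Y,Z$ with values in $\{0,1,2,\dots\}$ is $\|\mathcal L(Y)-\mathcal L(Z)\|=\sup_h|\mathbb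 E h(Y)-\mathbb E h(Z)|$, the supremum being over all real functions $h$ on $\{0,1,2,\dots\}$ with $\sup_{m\ge0}|h(m)|=1$. -/

import Mathlib

open MeasureTheory ProbabilityTheory Filter Asymptotics

noncomputable section

namespace GRG

/-- The probability `W_i W_j / (L_n + W_i W_j)` of the edge between `i ≠ j` for the vertex
weights `w`, where `L_n` is the sum of all `n` weights; it is `0` for `i = j`. -/
def edgeProb {n : ℕ} (w : Fin n → ℝ) (i j : Fin n) : ℝ :=
  if i = j then 0 else w i * w j / ((∑ l, w l) + w i * w j)

open Classical in
/-- The probability of obtaining exactly the graph `H` when every pair `i < j` is joined by an edge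
independently, with probability `edgeProb w i j`. -/
def graphProb {n : ℕ} (w : Fin n → ℝ) (H : SimpleGraph (Fin n)) : ℝ :=
  ∏ i, ∏ j ∈ Finset.Ioi i, if H.Adj i j then edgeProb w i j else 1 - edgeProb w i j

/-- The random graph `G` on `n` vertices is a generalized random graph with the random vertex
weights `W`: conditionally on the weights, the edges occur independently, with probabilities
`edgeProb`. As the graph takes finitely many values, its conditional law is given by the
conditional probabilities of the events `G = H`. -/
structure IsGeneralizedRandomGraph {Ω : Type*} [MeasurableSpace Ω] (P : Measure Ω) {n : ℕ}
    (W : Fin n → Ω → ℝ) (G : Ω → SimpleGraph (Fin n)) : Prop where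
  measurable_weight : ∀ i, Measurable (W i)
  measurable_graph : Measurable G
  condProb_eq : ∀ H : SimpleGraph (Fin n),
    P⟦{ω | G ω = H} | MeasurableSpace.comap (fun ω i => W i ω) inferInstance⟧
      =ᵐ[P] fun ω => graphProb (fun i => W i ω) H

/-- The edges `v_0 v_1, v_1 v_2, …, v_{k-1} v_0` of the closed walk through `v_0, …, v_{k-1}`. -/
def cycleEdges {n k : ℕ} (v : Fin k → Fin n) : Finset (Sym2 (Fin n)) :=
  Finset.univ.image fun i => s(v i, v (finRotate k i))

open Classical in
/-- The set `I(k)` of potential cycles of length `k ≥ 3` on `n` vertices. A cycle through distinct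
vertices `v_0, …, v_{k-1}` is identified with its set of edges, so that the choice of the starting
point and of the orientation does not matter. -/
def potentialCycles (n k : ℕ) : Finset (Finset (Sym2 (Fin n))) :=
  (Finset.univ.filter fun v : Fin k → Fin n => Function.Injective v).image cycleEdges

open Classical in
/-- The number of cycles of length `k` in `G`: the sum over all potential cycles of the indicator
that the cycle occurs in `G`. -/
def numCycles {n : ℕ} (k : ℕ) (G : SimpleGraph (Fin n)) : ℕ :=
  ∑ α ∈ potentialCycles n k, if (α : Set (Sym2 (Fin n))) ⊆ G.edgeSet then 1 else 0

/-- The total variation distance `sup_{‖h‖ = 1} |∫ h dμ - ∫ h dν|` of probability measures on `ℕ`,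
where `h` runs over the real functions with `sup_m |h m| = 1`. -/
def tvDist (μ ν : Measure ℕ) : ℝ :=
  sSup {d : ℝ | ∃ h : ℕ → ℝ, IsLUB (Set.range fun m => |h m|) 1 ∧
    d = |(∫ m, h m ∂μ) - ∫ m, h m ∂ν|}

end GRG

end

/-!
Conditionally on the weights, the number `S` of cycles of length `k` counts the members of a family
of edge sets (`potentialCycles`) which are contained in a random set of edges with independent
elements (`sum_graphProb_mul`), so the Chen–Stein method applies. Let `f` be the solution of the
Stein equation `r * f (j + 1) - j * f j = h j - E h(Z)` of the Poisson distribution with the *limit*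
parameter `r` (`exists_stein_solution`); it is bounded in terms of `r` alone. Then, given the
weights, `|E h(S) - E h(Z)|` is at most a constant times
* the difference of `r` and the conditional mean of `S`, plus
* the sum of the probabilities belonging to pairs of cycles with a common edge
  (`abs_stein_countSubsets_le`, `abs_condExpect_sub_le_stein`).
As the parameter `r` is fixed, crude bounds on `f` suffice, and no control of the Stein factors for
random parameters is needed.

Both terms are estimated when `∑ w x` is not too small and `∑ w x ^ 2` is not too large; the
exceptional weights have probability `O(1 / n)` by Chebyshev's inequality.

The conditional mean is `1 / (2 k)` times a sum over tuples of distinct vertices, since each cycle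
is represented by exactly `2 k` tuples (`sum_potentialCycles`). Up to a multiple of
`n ^ (-2) * ∑ w x ^ 4` it equals `(∑ w x ^ 2 / ∑ w x) ^ k / (2 k)` (`abs_condMean_sub_le`), and
`∑ w x ^ 2 / ∑ w x` differs from `E W ^ 2 / E W` by `O(n ^ (-1/2))` in mean, by the variance of sums
of independent variables. This is the term which determines the rate.

For the overlapping pairs, a second cycle with `u` vertices outside the first one has at least
`u + 1` edges outside it, unless the cycles coincide (`exists_extra_edges`). There are
`O(n ^ (k + u))` such pairs, each with probability at most a multiple of `n ^ (-(k + u + 1))` times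
a product of at most fourth powers of weights, hence their total contribution is `O(1 / n)`
(`overlapSum_le`, `sum_newIndices_le`, `integral_overlapMoment`).

All these bounds are collected in `errorBound`. Only the fourth moment of the weights is needed,
which is finite by the tail condition as `k ≥ 3`.
-/

noncomputable section

namespace GRG

/-! ### The Stein equation of the Poisson distribution -/

/-- The solution of the Stein equation `lam * f (j + 1) - j * f j = g j` for a function `g` whose
Poisson mean vanishes, written through the upper tail of the Poisson weights. The value at `0`
is irrelevant. -/
def steinSol (lam : ℝ) (g : ℕ → ℝ) : ℕ → ℝ
  | 0 => 0
  | j + 1 => -∑' i : ℕ, g (j + 1 + i) * (lam ^ i * j.factorial / (j + 1 + i).factorial)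

lemma steinSol_coeff_le {lam : ℝ} (hl : 0 ≤ lam) (j i : ℕ) :
    lam ^ i * j.factorial / (j + 1 + i).factorial ≤ lam ^ i / i.factorial := by
  rw [div_le_div_iff₀ (by positivity) (by positivity), mul_assoc]
  gcongr
  have h1 : j.factorial * i.factorial ≤ (j + i).factorial :=
    Nat.le_of_dvd (Nat.factorial_pos _) (Nat.factorial_mul_factorial_dvd_factorial_add j i)
  have h2 : (j + i).factorial ≤ (j + 1 + i).factorial := Nat.factorial_le (by omega)
  exact_mod_cast h1.trans h2

lemma steinSol_term_le {lam K : ℝ} (hl : 0 ≤ lam) {g : ℕ → ℝ} (hg : ∀ j, |g j| ≤ K) (j i : ℕ) :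
    ‖g (j + 1 + i) * (lam ^ i * j.factorial / (j + 1 + i).factorial)‖
      ≤ K * (lam ^ i / i.factorial) := by
  rw [norm_mul, Real.norm_eq_abs, Real.norm_of_nonneg (by positivity)]
  exact mul_le_mul (hg _) (steinSol_coeff_le hl j i) (by positivity) ((abs_nonneg _).trans (hg 0))

lemma hasSum_pow_div_factorial (lam : ℝ) :
    HasSum (fun i : ℕ => lam ^ i / i.factorial) (Real.exp lam) := by
  rw [Real.exp_eq_exp_ℝ]
  exact NormedSpace.expSeries_div_hasSum_exp lam

lemma summable_steinSol_term {lam K : ℝ} (hl : 0 ≤ lam) {g : ℕ → ℝ} (hg : ∀ j, |g j| ≤ K)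
    (j : ℕ) : Summable fun i : ℕ =>
      g (j + 1 + i) * (lam ^ i * j.factorial / (j + 1 + i).factorial) :=
  Summable.of_norm_bounded ((hasSum_pow_div_factorial lam).summable.mul_left K)
    (steinSol_term_le hl hg j)

lemma abs_steinSol_le {lam K : ℝ} (hl : 0 ≤ lam) {g : ℕ → ℝ} (hg : ∀ j, |g j| ≤ K) (j : ℕ) :
    |steinSol lam g j| ≤ K * Real.exp lam := by
  have hK : 0 ≤ K := (abs_nonneg _).trans (hg 0)
  cases j with
  | zero => simp only [steinSol, abs_zero]; positivity
  | succ j =>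
    rw [steinSol, abs_neg]
    exact tsum_of_norm_bounded ((hasSum_pow_div_factorial lam).mul_left K)
      (steinSol_term_le hl hg j)

lemma steinSol_eq {lam K : ℝ} (hl : 0 ≤ lam) {g : ℕ → ℝ} (hg : ∀ j, |g j| ≤ K)
    (h0 : ∑' i : ℕ, g i * (lam ^ i / i.factorial) = 0) (j : ℕ) :
    lam * steinSol lam g (j + 1) - j * steinSol lam g j = g j := by
  cases j with
  | zero =>
    have hs : Summable fun i : ℕ => g i * (lam ^ i / i.factorial) := by
      refine Summable.of_norm_bounded ((hasSum_pow_div_factorial lam).summable.mul_left K)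
        fun i => ?_
      rw [norm_mul, Real.norm_eq_abs, Real.norm_of_nonneg (by positivity)]
      exact mul_le_mul_of_nonneg_right (hg i) (by positivity)
    rw [hs.tsum_eq_zero_add] at h0
    have : lam * ∑' i : ℕ, g (0 + 1 + i) * (lam ^ i * (0 : ℕ).factorial / (0 + 1 + i).factorial)
        = ∑' i : ℕ, g (i + 1) * (lam ^ (i + 1) / (i + 1).factorial) := by
      rw [← tsum_mul_left]
      refine tsum_congr fun i => ?_
      rw [show 0 + 1 + i = i + 1 by ring, pow_succ]
      simp only [Nat.factorial_zero, Nat.cast_one]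
      ring
    simp only [steinSol, mul_neg, this, Nat.cast_zero]
    simp at h0 ⊢
    linarith
  | succ j =>
    have hs := summable_steinSol_term hl hg j
    have e : ∑' i : ℕ, g (j + 1 + i) * (lam ^ i * j.factorial / (j + 1 + i).factorial)
        = g (j + 1) * (j.factorial / (j + 1).factorial)
          + ∑' i : ℕ, g (j + 1 + (i + 1)) *
              (lam ^ (i + 1) * j.factorial / (j + 1 + (i + 1)).factorial) := by
      rw [hs.tsum_eq_zero_add]
      simp
    have e2 : lam * ∑' i : ℕ, g (j + 1 + 1 + i) *
          (lam ^ i * (j + 1).factorial / (j + 1 + 1 + i).factorial)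
        = ((j + 1 : ℕ) : ℝ) * ∑' i : ℕ, g (j + 1 + (i + 1)) *
              (lam ^ (i + 1) * j.factorial / (j + 1 + (i + 1)).factorial) := by
      rw [← tsum_mul_left, ← tsum_mul_left]
      refine tsum_congr fun i => ?_
      rw [show j + 1 + 1 + i = j + 1 + (i + 1) by ring, pow_succ, Nat.factorial_succ j]
      push_cast
      ring
    have e3 : ((j + 1 : ℕ) : ℝ) * (g (j + 1) * (j.factorial / (j + 1).factorial)) = g (j + 1) := by
      rw [Nat.factorial_succ]
      push_cast
      have : (j.factorial : ℝ) ≠ 0 := by positivity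
      have : (j : ℝ) + 1 ≠ 0 := by positivity
      field_simp
    simp only [steinSol]
    rw [e, mul_neg, e2, mul_neg, mul_add, e3]
    ring

/-- For bounded `h`, the Stein equation of the Poisson distribution has a bounded solution. The
constant `2 * exp r` is far from optimal, but it depends on the parameter only. -/
lemma exists_stein_solution (r : NNReal) {h : ℕ → ℝ} (hh : ∀ j, |h j| ≤ 1) :
    ∃ f : ℕ → ℝ, (∀ j, |f j| ≤ 2 * Real.exp r) ∧
      ∀ j : ℕ, (r : ℝ) * f (j + 1) - j * f j = h j - ∫ m, h m ∂poissonMeasure r := by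
  have hint : Integrable h (poissonMeasure r) :=
    Integrable.of_bound (by fun_prop) 1 (Eventually.of_forall hh)
  set c := ∫ m, h m ∂poissonMeasure r with hc
  have hc1 : |c| ≤ 1 := by
    have := norm_integral_le_of_norm_le_const (μ := poissonMeasure r) (f := h) (C := 1)
      (Eventually.of_forall hh)
    simpa using this
  have hg : ∀ j, |h j - c| ≤ 2 := fun j => by
    have := abs_sub (h j) c
    have := hh j
    linarith
  refine ⟨steinSol r fun j => h j - c, fun j => abs_steinSol_le r.coe_nonneg hg j,
    fun j => steinSol_eq r.coe_nonneg hg ?_ j⟩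
  have h1 := hasSum_integral_poissonMeasure hint
  have h2 := (hasSum_one_poissonMeasure r).mul_left c
  have h3 := (h1.sub h2).mul_left (Real.exp r)
  rw [← hc, mul_one, sub_self, mul_zero] at h3
  refine Eq.trans (tsum_congr fun i => ?_) h3.tsum_eq
  have : Real.exp (r : ℝ) * Real.exp (-r) = 1 := by rw [← Real.exp_add]; simp
  simp only [smul_eq_mul]
  linear_combination (-((h i - c) * ((r : ℝ) ^ i / i.factorial))) * this

/-! ### Random subsets with independent elements -/

section RandomSubset

variable {E : Type*} [DecidableEq E]

/-- The number of members of the family `I` contained in `s`. -/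
def countSubsets (I : Finset (Finset E)) (s : Finset E) : ℕ := ∑ α ∈ I, if α ⊆ s then 1 else 0

lemma countSubsets_split (I : Finset (Finset E)) (α s : Finset E) :
    countSubsets I s = countSubsets (I.filter fun β => Disjoint α β) s
      + countSubsets (I.filter fun β => ¬Disjoint α β) s :=
  (Finset.sum_filter_add_sum_filter_not I _ _).symm

lemma countSubsets_cast (I : Finset (Finset E)) (s : Finset E) :
    (countSubsets I s : ℝ) = ∑ α ∈ I, if α ⊆ s then (1 : ℝ) else 0 := by
  simp [countSubsets]

/-- The error term of the Poisson approximation of `countSubsets I`: it collects the pairs of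
members of `I` which meet, and hence are dependent. -/
def overlapSum (p : E → ℝ) (I : Finset (Finset E)) : ℝ :=
  ∑ α ∈ I, ∑ β ∈ I with ¬Disjoint α β,
    ((∏ e ∈ α, p e) * (∏ e ∈ β, p e) + if β = α then 0 else ∏ e ∈ α ∪ β, p e)

lemma abs_sub_le_mul_of_bound {f : ℕ → ℝ} {K : ℝ} (hf : ∀ j, |f j| ≤ K) (a d : ℕ) :
    |f (a + d) - f a| ≤ 2 * K * d := by
  have hK : 0 ≤ K := (abs_nonneg _).trans (hf 0)
  rcases Nat.eq_zero_or_pos d with rfl | hd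
  · simp
  · have h1 : (1 : ℝ) ≤ d := by exact_mod_cast hd
    have := abs_sub (f (a + d)) (f a)
    have := hf (a + d)
    have := hf a
    nlinarith

variable [Fintype E]

/-- The probability of obtaining exactly the set `s` when every `e` is chosen independently, with
probability `p e`. -/
def subsetProb (p : E → ℝ) (s : Finset E) : ℝ := ∏ e, if e ∈ s then p e else 1 - p e

/-- The expectation of `F` under `subsetProb p`. -/
def subsetExp (p : E → ℝ) (F : Finset E → ℝ) : ℝ := ∑ s, subsetProb p s * F s

lemma subsetProb_nonneg {p : E → ℝ} (h0 : ∀ e, 0 ≤ p e) (h1 : ∀ e, p e ≤ 1) (s : Finset E) :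
    0 ≤ subsetProb p s :=
  Finset.prod_nonneg fun e _ => by split_ifs; exacts [h0 e, sub_nonneg.2 (h1 e)]

lemma sum_subsetProb (p : E → ℝ) : ∑ s, subsetProb p s = 1 := by
  have h := Finset.prod_add p (fun e => 1 - p e) Finset.univ
  simp only [add_sub_cancel, Finset.prod_const_one, Finset.powerset_univ] at h
  rw [h]
  refine Finset.sum_congr rfl fun s _ => ?_
  rw [subsetProb, Finset.prod_ite]
  congr 1
  · exact Finset.prod_congr (by ext; simp) fun _ _ => rfl
  · exact Finset.prod_congr (by ext; simp) fun _ _ => rfl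

lemma subsetExp_const (p : E → ℝ) (c : ℝ) : subsetExp p (fun _ => c) = c := by
  rw [subsetExp, ← Finset.sum_mul, sum_subsetProb, one_mul]

lemma subsetExp_add (p : E → ℝ) (F F' : Finset E → ℝ) :
    subsetExp p (fun s => F s + F' s) = subsetExp p F + subsetExp p F' := by
  simp only [subsetExp, mul_add, Finset.sum_add_distrib]

lemma subsetExp_sub (p : E → ℝ) (F F' : Finset E → ℝ) :
    subsetExp p (fun s => F s - F' s) = subsetExp p F - subsetExp p F' := by
  simp only [subsetExp, mul_sub, Finset.sum_sub_distrib]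

lemma subsetExp_const_mul (p : E → ℝ) (c : ℝ) (F : Finset E → ℝ) :
    subsetExp p (fun s => c * F s) = c * subsetExp p F := by
  simp only [subsetExp, Finset.mul_sum]
  exact Finset.sum_congr rfl fun _ _ => by ring

lemma subsetExp_sum {ι : Type*} (I : Finset ι) (p : E → ℝ) (F : ι → Finset E → ℝ) :
    subsetExp p (fun s => ∑ i ∈ I, F i s) = ∑ i ∈ I, subsetExp p (F i) := by
  simp only [subsetExp, Finset.mul_sum]
  exact Finset.sum_comm

lemma subsetExp_mono {p : E → ℝ} (h0 : ∀ e, 0 ≤ p e) (h1 : ∀ e, p e ≤ 1) {F F' : Finset E → ℝ}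
    (h : ∀ s, F s ≤ F' s) : subsetExp p F ≤ subsetExp p F' :=
  Finset.sum_le_sum fun s _ => mul_le_mul_of_nonneg_left (h s) (subsetProb_nonneg h0 h1 s)

lemma abs_subsetExp_le {p : E → ℝ} (h0 : ∀ e, 0 ≤ p e) (h1 : ∀ e, p e ≤ 1) (F : Finset E → ℝ) :
    |subsetExp p F| ≤ subsetExp p fun s => |F s| := by
  refine (Finset.abs_sum_le_sum_abs _ _).trans (le_of_eq (Finset.sum_congr rfl fun s _ => ?_))
  rw [abs_mul, abs_of_nonneg (subsetProb_nonneg h0 h1 s)]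

/-- The event that `e` is chosen is independent of a function of the other choices. -/
lemma subsetExp_mem_mul (p : E → ℝ) (e : E) (F : Finset E → ℝ)
    (hF : ∀ s, e ∉ s → F (insert e s) = F s) :
    subsetExp p (fun s => if e ∈ s then F s else 0) = p e * subsetExp p F := by
  have key : ∀ H : Finset E → ℝ, ∑ s, H s
      = ∑ s ∈ (Finset.univ.erase e).powerset, (H s + H (insert e s)) := fun H => by
    rw [Finset.sum_add_distrib, ← Finset.sum_powerset_insert (Finset.notMem_erase e _),
      Finset.insert_erase (Finset.mem_univ e), Finset.powerset_univ]
  rw [subsetExp, subsetExp, key, key, Finset.mul_sum]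
  refine Finset.sum_congr rfl fun s hs => ?_
  have hes : e ∉ s := fun h => Finset.notMem_erase e _ (Finset.mem_powerset.1 hs h)
  have q1 : subsetProb p s
      = (1 - p e) * ∏ x ∈ Finset.univ.erase e, if x ∈ s then p x else 1 - p x := by
    rw [subsetProb, ← Finset.mul_prod_erase _ _ (Finset.mem_univ e), if_neg hes]
  have q2 : subsetProb p (insert e s)
      = p e * ∏ x ∈ Finset.univ.erase e, if x ∈ s then p x else 1 - p x := by
    rw [subsetProb, ← Finset.mul_prod_erase _ _ (Finset.mem_univ e),
      if_pos (Finset.mem_insert_self e s)]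
    congr 1
    refine Finset.prod_congr rfl fun x hx => ?_
    simp [Finset.mem_insert, Finset.ne_of_mem_erase hx]
  rw [q1, q2, hF s hes, if_neg hes, if_pos (Finset.mem_insert_self e s)]
  ring

/-- The event that all elements of `α` are chosen is independent of a function of the choices
outside `α`. -/
lemma subsetExp_subset_mul (p : E → ℝ) (α : Finset E) (F : Finset E → ℝ)
    (hF : ∀ e ∈ α, ∀ s, e ∉ s → F (insert e s) = F s) :
    subsetExp p (fun s => if α ⊆ s then F s else 0) = (∏ e ∈ α, p e) * subsetExp p F := by
  induction α using Finset.induction_on with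
  | empty => simp
  | insert a t hat ih =>
    rw [Finset.prod_insert hat, mul_assoc, ← ih fun e he => hF e (Finset.mem_insert_of_mem he),
      ← subsetExp_mem_mul]
    · congr 1
      ext s
      by_cases ha : a ∈ s <;> by_cases ht : t ⊆ s <;> simp [Finset.insert_subset_iff, ha, ht]
    · intro s hs
      have : t ⊆ insert a s ↔ t ⊆ s := by
        rw [Finset.subset_insert_iff_of_notMem hat]
      simp only [this, hF a (Finset.mem_insert_self a t) s hs]

lemma subsetExp_subset (p : E → ℝ) (α : Finset E) :
    subsetExp p (fun s => if α ⊆ s then 1 else 0) = ∏ e ∈ α, p e := by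
  rw [subsetExp_subset_mul p α (fun _ => 1) fun _ _ _ _ => rfl, subsetExp_const, mul_one]

/-- The Chen–Stein bound: for a family `I` of nonempty sets, the number of members of `I` contained
in a random set with independent elements almost satisfies the Stein identity of the Poisson
distribution with the same mean. -/
lemma abs_stein_countSubsets_le {p : E → ℝ} (h0 : ∀ e, 0 ≤ p e) (h1 : ∀ e, p e ≤ 1)
    (I : Finset (Finset E)) (hI : ∀ α ∈ I, α.Nonempty) {f : ℕ → ℝ} {K : ℝ}
    (hf : ∀ j, |f j| ≤ K) :
    |subsetExp p fun s => (∑ α ∈ I, ∏ e ∈ α, p e) * f (countSubsets I s + 1)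
        - countSubsets I s * f (countSubsets I s)| ≤ 2 * K * overlapSum p I := by
  have hK : 0 ≤ K := (abs_nonneg _).trans (hf 0)
  -- the number of members contained in `s` and disjoint from `α`, which is independent of `α ⊆ s`
  set N : Finset E → Finset E → ℕ := fun α s => countSubsets (I.filter fun β => Disjoint α β) s
    with hN
  have hind : ∀ α, subsetExp p (fun s => if α ⊆ s then f (N α s + 1) else 0)
      = (∏ e ∈ α, p e) * subsetExp p fun s => f (N α s + 1) := by
    intro α
    refine subsetExp_subset_mul p α (fun s => f (N α s + 1)) fun e he s hes => ?_
    have : N α (insert e s) = N α s := by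
      refine Finset.sum_congr rfl fun β hβ => ?_
      have hd := (Finset.mem_filter.1 hβ).2
      simp only [Finset.subset_insert_iff_of_notMem fun h => Finset.disjoint_left.1 hd he h]
    simp only [this]
  have hterm : ∀ s, (∑ α ∈ I, ∏ e ∈ α, p e) * f (countSubsets I s + 1)
        - countSubsets I s * f (countSubsets I s)
      = ∑ α ∈ I, ((∏ e ∈ α, p e) * f (countSubsets I s + 1)
        - if α ⊆ s then f (countSubsets I s) else 0) := by
    intro s
    rw [Finset.sum_sub_distrib, Finset.sum_mul]
    congr 1
    rw [countSubsets_cast, Finset.sum_mul]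
    exact Finset.sum_congr rfl fun α _ => by split_ifs <;> simp
  simp only [hterm]
  rw [subsetExp_sum, overlapSum, Finset.mul_sum]
  refine (Finset.abs_sum_le_sum_abs _ _).trans (Finset.sum_le_sum fun α hα => ?_)
  rw [Finset.sum_add_distrib, mul_add]
  have hsplit : subsetExp p (fun s => (∏ e ∈ α, p e) * f (countSubsets I s + 1)
        - if α ⊆ s then f (countSubsets I s) else 0)
      = (∏ e ∈ α, p e) * subsetExp p (fun s => f (countSubsets I s + 1) - f (N α s + 1))
        - subsetExp p (fun s => if α ⊆ s then f (countSubsets I s) - f (N α s + 1) else 0) := by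
    rw [subsetExp_sub, subsetExp_sub, mul_sub, ← hind, subsetExp_const_mul]
    have : subsetExp p (fun s => if α ⊆ s then f (countSubsets I s) - f (N α s + 1) else 0)
        = subsetExp p (fun s => if α ⊆ s then f (countSubsets I s) else 0)
          - subsetExp p (fun s => if α ⊆ s then f (N α s + 1) else 0) := by
      rw [← subsetExp_sub]
      congr 1
      ext s
      split_ifs <;> simp
    rw [this]
    ring
  rw [hsplit]
  refine (abs_sub _ _).trans (add_le_add ?_ ?_)
  · rw [abs_mul, abs_of_nonneg (Finset.prod_nonneg fun e _ => h0 e), ← Finset.mul_sum,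
      mul_left_comm (2 * K)]
    refine mul_le_mul_of_nonneg_left ?_ (Finset.prod_nonneg fun e _ => h0 e)
    refine (abs_subsetExp_le h0 h1 _).trans ?_
    have e1 : subsetExp p (fun s =>
          2 * K * (countSubsets (I.filter fun β => ¬Disjoint α β) s : ℝ))
        = 2 * K * ∑ β ∈ I with ¬Disjoint α β, ∏ e ∈ β, p e := by
      simp only [countSubsets_cast]
      rw [subsetExp_const_mul, subsetExp_sum]
      simp only [subsetExp_subset]
    rw [← e1]
    refine subsetExp_mono h0 h1 fun s => ?_
    rw [countSubsets_split I α s, add_right_comm]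
    exact abs_sub_le_mul_of_bound hf _ _
  · refine (abs_subsetExp_le h0 h1 _).trans ?_
    have e1 : subsetExp p (fun s => 2 * K * ∑ β ∈ I with ¬Disjoint α β,
          if β = α then 0 else if α ∪ β ⊆ s then 1 else 0)
        = 2 * K * ∑ β ∈ I with ¬Disjoint α β, if β = α then 0 else ∏ e ∈ α ∪ β, p e := by
      rw [subsetExp_const_mul, subsetExp_sum]
      congr 1
      refine Finset.sum_congr rfl fun β _ => ?_
      split_ifs with h
      · exact subsetExp_const p 0
      · exact subsetExp_subset p _
    rw [← e1]
    refine subsetExp_mono h0 h1 fun s => ?_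
    by_cases hs : α ⊆ s
    · rw [if_pos hs]
      have hmem : α ∈ I.filter fun β => ¬Disjoint α β := by
        refine Finset.mem_filter.2 ⟨hα, ?_⟩
        rw [disjoint_self]
        exact (hI α hα).ne_empty
      -- `α` itself accounts for the shift by one
      have e2 : countSubsets I s = N α s + 1 + ∑ β ∈ (I.filter fun β => ¬Disjoint α β).erase α,
          if β ⊆ s then 1 else 0 := by
        rw [countSubsets_split I α s, add_assoc]
        congr 1
        rw [countSubsets, ← Finset.add_sum_erase _ _ hmem, if_pos hs]
      have e3 : ∑ β ∈ I with ¬Disjoint α β, (if β = α then 0 else if α ∪ β ⊆ s then (1 : ℝ) else 0)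
          = ((∑ β ∈ (I.filter fun β => ¬Disjoint α β).erase α,
            if β ⊆ s then 1 else 0 : ℕ) : ℝ) := by
        rw [← Finset.add_sum_erase _ _ hmem, if_pos rfl, zero_add, Nat.cast_sum]
        refine Finset.sum_congr rfl fun β hβ => ?_
        rw [if_neg (Finset.ne_of_mem_erase hβ)]
        simp [Finset.union_subset_iff, hs]
      rw [e3, e2]
      exact abs_sub_le_mul_of_bound hf _ _
    · rw [if_neg hs, abs_zero]
      exact mul_nonneg (by positivity) (Finset.sum_nonneg fun β _ => by split_ifs <;> norm_num)

end RandomSubset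

/-! ### The generalized random graph with fixed weights -/

lemma edgeProb_comm {n : ℕ} (w : Fin n → ℝ) (i j : Fin n) : edgeProb w i j = edgeProb w j i := by
  simp only [edgeProb, eq_comm (a := i), mul_comm (w i)]

/-- The edge probabilities as a function on unordered pairs, with the value `0` on the diagonal. -/
def symEdgeProb {n : ℕ} (w : Fin n → ℝ) : Sym2 (Fin n) → ℝ :=
  Sym2.lift ⟨edgeProb w, edgeProb_comm w⟩

@[simp]
lemma symEdgeProb_mk {n : ℕ} (w : Fin n → ℝ) (i j : Fin n) :
    symEdgeProb w s(i, j) = edgeProb w i j := rfl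

lemma symEdgeProb_of_isDiag {n : ℕ} (w : Fin n → ℝ) {e : Sym2 (Fin n)} (he : e.IsDiag) :
    symEdgeProb w e = 0 := by
  induction e with
  | _ i j => simp [edgeProb, Sym2.mk_isDiag_iff.1 he]

lemma edgeProb_nonneg {n : ℕ} {w : Fin n → ℝ} (hw : ∀ i, 0 < w i) (i j : Fin n) :
    0 ≤ edgeProb w i j := by
  have hL : 0 ≤ ∑ l, w l := Finset.sum_nonneg fun l _ => (hw l).le
  have := mul_pos (hw i) (hw j)
  rw [edgeProb]
  split_ifs
  · exact le_rfl
  · positivity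

lemma edgeProb_le_one {n : ℕ} {w : Fin n → ℝ} (hw : ∀ i, 0 < w i) (i j : Fin n) :
    edgeProb w i j ≤ 1 := by
  have hL : 0 ≤ ∑ l, w l := Finset.sum_nonneg fun l _ => (hw l).le
  have := mul_pos (hw i) (hw j)
  rw [edgeProb]
  split_ifs
  · exact zero_le_one
  · rw [div_le_one (by positivity)]
    linarith

lemma symEdgeProb_nonneg {n : ℕ} {w : Fin n → ℝ} (hw : ∀ i, 0 < w i) (e : Sym2 (Fin n)) :
    0 ≤ symEdgeProb w e := by
  induction e with
  | _ i j => exact edgeProb_nonneg hw i j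

lemma symEdgeProb_le_one {n : ℕ} {w : Fin n → ℝ} (hw : ∀ i, 0 < w i) (e : Sym2 (Fin n)) :
    symEdgeProb w e ≤ 1 := by
  induction e with
  | _ i j => exact edgeProb_le_one hw i j

open Classical in
/-- The edge set of a graph on `Fin n` as a `Finset`. -/
def edges {n : ℕ} (H : SimpleGraph (Fin n)) : Finset (Sym2 (Fin n)) :=
  Finset.univ.filter fun e => e ∈ H.edgeSet

lemma mem_edges {n : ℕ} {H : SimpleGraph (Fin n)} {e : Sym2 (Fin n)} :
    e ∈ edges H ↔ e ∈ H.edgeSet := by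
  simp [edges]

lemma coe_edges {n : ℕ} (H : SimpleGraph (Fin n)) : (edges H : Set (Sym2 (Fin n))) = H.edgeSet := by
  ext e
  simp [mem_edges]

lemma graphProb_eq_subsetProb {n : ℕ} (w : Fin n → ℝ) (H : SimpleGraph (Fin n)) :
    graphProb w H = subsetProb (symEdgeProb w) (edges H) := by
  classical
  rw [subsetProb, ← Finset.prod_filter_mul_prod_filter_not Finset.univ
    (fun e : Sym2 (Fin n) => e.IsDiag)]
  have h1 : ∏ e : Sym2 (Fin n) with e.IsDiag,
      (if e ∈ edges H then symEdgeProb w e else 1 - symEdgeProb w e) = 1 := by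
    refine Finset.prod_eq_one fun e he => ?_
    have hd := (Finset.mem_filter.1 he).2
    rw [if_neg fun h => H.not_isDiag_of_mem_edgeSet (mem_edges.1 h) hd,
      symEdgeProb_of_isDiag w hd, sub_zero]
  rw [h1, one_mul, graphProb, Finset.prod_sigma']
  refine Finset.prod_bij (fun x _ => s(x.1, x.2)) ?_ ?_ ?_ ?_
  · rintro ⟨i, j⟩ h
    simp only [Finset.mem_sigma, Finset.mem_univ, Finset.mem_Ioi, true_and] at h
    simp [h.ne]
  · rintro ⟨i, j⟩ h ⟨i', j'⟩ h' he
    simp only [Finset.mem_sigma, Finset.mem_univ, Finset.mem_Ioi, true_and] at h h'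
    rcases Sym2.eq_iff.1 he with ⟨h1, h2⟩ | ⟨h1, h2⟩
    · simp_all
    · dsimp only at h1 h2
      subst h1 h2
      exact absurd h h'.asymm
  · intro e he
    induction e with
    | _ i j =>
      simp only [Finset.mem_filter, Finset.mem_univ, true_and, Sym2.mk_isDiag_iff] at he
      rcases lt_or_gt_of_ne he with h | h
      · exact ⟨⟨i, j⟩, by simp [h], rfl⟩
      · exact ⟨⟨j, i⟩, by simp [h], Sym2.eq_swap⟩
  · rintro ⟨i, j⟩ _
    simp [mem_edges]

lemma edges_injective {n : ℕ} : Function.Injective (edges (n := n)) := fun H H' h => by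
  rw [← SimpleGraph.edgeSet_inj, ← coe_edges, ← coe_edges, h]

lemma sum_graphProb_mul {n : ℕ} (w : Fin n → ℝ) (F : Finset (Sym2 (Fin n)) → ℝ) :
    ∑ H : SimpleGraph (Fin n), graphProb w H * F (edges H) = subsetExp (symEdgeProb w) F := by
  classical
  refine Finset.sum_of_injOn edges edges_injective.injOn (by simp) (fun s _ hs => ?_)
    fun H _ => by rw [graphProb_eq_subsetProb]
  -- a set which is not the edge set of a graph contains a loop, hence has probability zero
  have : ∃ e ∈ s, e.IsDiag := by
    by_contra! hcon
    refine hs ⟨SimpleGraph.fromEdgeSet (s : Set (Sym2 (Fin n))), by simp, ?_⟩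
    ext e
    rw [mem_edges, SimpleGraph.edgeSet_fromEdgeSet]
    simp only [Set.mem_sdiff, Finset.mem_coe]
    exact ⟨fun h => h.1, fun h => ⟨h, hcon e h⟩⟩
  obtain ⟨e, hes, hed⟩ := this
  rw [subsetProb, Finset.prod_eq_zero (Finset.mem_univ e), zero_mul]
  rw [if_pos hes, symEdgeProb_of_isDiag w hed]

lemma numCycles_eq {n : ℕ} (k : ℕ) (H : SimpleGraph (Fin n)) :
    numCycles k H = countSubsets (potentialCycles n k) (edges H) := by
  classical
  rw [numCycles, countSubsets]
  refine Finset.sum_congr rfl fun α _ => ?_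
  simp only [← Finset.coe_subset, coe_edges]

lemma sum_graphProb {n : ℕ} (w : Fin n → ℝ) : ∑ H : SimpleGraph (Fin n), graphProb w H = 1 := by
  have := sum_graphProb_mul w fun _ => 1
  rw [subsetExp_const] at this
  simpa using this

lemma graphProb_nonneg {n : ℕ} {w : Fin n → ℝ} (hw : ∀ i, 0 < w i) (H : SimpleGraph (Fin n)) :
    0 ≤ graphProb w H := by
  rw [graphProb_eq_subsetProb]
  exact subsetProb_nonneg (symEdgeProb_nonneg hw) (symEdgeProb_le_one hw) _

/-! ### The tuples representing a cycle -/

lemma fin_add_two_ne {k : ℕ} [NeZero k] (hk : 3 ≤ k) (i : Fin k) : i + 1 + 1 ≠ i := by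
  obtain ⟨m, rfl⟩ : ∃ m, k = m + 3 := ⟨k - 3, by omega⟩
  intro h
  rw [add_assoc, add_eq_left] at h
  have := congrArg Fin.val h
  simp [Fin.val_add, Nat.mod_eq_of_lt (show 2 < m + 3 by omega)] at this

lemma fin_cyclic_induction {k : ℕ} [NeZero k] {Q : Fin k → Prop} {a : Fin k} (ha : Q a)
    (hs : ∀ i, Q i → Q (i + 1)) (i : Fin k) : Q i := by
  have h : ∀ m : ℕ, Q (a + Fin.ofNat k m) := by
    intro m
    induction m with
    | zero => simpa [Fin.ofNat_zero] using ha
    | succ m ih =>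
      have : Fin.ofNat k (m + 1) = Fin.ofNat k m + 1 := by
        ext
        simp [Fin.val_add, Fin.ofNat]
      rw [this, ← add_assoc]
      exact hs _ ih
  have := h (i - a).val
  rwa [Fin.ofNat_val_eq_self, add_sub_cancel] at this

/-- The `i`-th edge of the closed walk through `v`. -/
def walkEdge {n k : ℕ} [NeZero k] (v : Fin k → Fin n) (i : Fin k) : Sym2 (Fin n) :=
  s(v i, v (i + 1))

lemma cycleEdges_eq {n k : ℕ} [NeZero k] (v : Fin k → Fin n) :
    cycleEdges v = Finset.univ.image (walkEdge v) := by
  simp only [cycleEdges, finRotate_apply]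
  rfl

lemma mem_cycleEdges {n k : ℕ} [NeZero k] {v : Fin k → Fin n} {x y : Fin n} :
    s(x, y) ∈ cycleEdges v ↔
      ∃ i, (x = v i ∧ y = v (i + 1)) ∨ (x = v (i + 1) ∧ y = v i) := by
  simp only [cycleEdges_eq, walkEdge, Finset.mem_image, Finset.mem_univ, true_and, Sym2.eq_iff,
    eq_comm (a := x), eq_comm (a := y)]
  exact exists_congr fun i => or_congr Iff.rfl and_comm

lemma mem_range_of_mem_cycleEdges {n k : ℕ} [NeZero k] {v : Fin k → Fin n} {x y : Fin n}
    (h : s(x, y) ∈ cycleEdges v) : x ∈ Set.range v ∧ y ∈ Set.range v := by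
  obtain ⟨i, ⟨rfl, rfl⟩ | ⟨rfl, rfl⟩⟩ := mem_cycleEdges.1 h <;> simp

lemma walkEdge_injective {n k : ℕ} [NeZero k] (hk : 3 ≤ k) {v : Fin k → Fin n}
    (hv : Function.Injective v) : Function.Injective (walkEdge v) := by
  intro i j h
  rcases Sym2.eq_iff.1 h with ⟨h1, -⟩ | ⟨h1, h2⟩
  · exact hv h1
  · have h1 := hv h1
    have h2 := hv h2
    exact absurd (by rw [← h1, h2]) (fin_add_two_ne hk j)

lemma card_cycleEdges {n k : ℕ} [NeZero k] (hk : 3 ≤ k) {v : Fin k → Fin n}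
    (hv : Function.Injective v) : (cycleEdges v).card = k := by
  rw [cycleEdges_eq, Finset.card_image_of_injective _ (walkEdge_injective hk hv),
    Finset.card_univ, Fintype.card_fin]

lemma prod_cycleEdges {n k : ℕ} [NeZero k] (hk : 3 ≤ k) {v : Fin k → Fin n}
    (hv : Function.Injective v) (p : Sym2 (Fin n) → ℝ) :
    ∏ e ∈ cycleEdges v, p e = ∏ i, p (walkEdge v i) := by
  rw [cycleEdges_eq, Finset.prod_image (walkEdge_injective hk hv).injOn]

/-- The traversals of the closed walk through `v`: the starting point is `v a`, and the orientation
is kept or reversed. -/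
def traversal {n k : ℕ} [NeZero k] (v : Fin k → Fin n) (a : Fin k × Bool) (i : Fin k) : Fin n :=
  if a.2 then v (a.1 + i) else v (a.1 - i)

lemma traversal_injective_right {n k : ℕ} [NeZero k] {v : Fin k → Fin n}
    (hv : Function.Injective v) (a : Fin k × Bool) : Function.Injective (traversal v a) := by
  intro i j h
  unfold traversal at h
  split_ifs at h
  · exact add_left_cancel (hv h)
  · exact sub_right_injective (hv h)

lemma traversal_injective_left {n k : ℕ} [NeZero k] (hk : 3 ≤ k) {v : Fin k → Fin n}
    (hv : Function.Injective v) : Function.Injective (traversal v) := by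
  rintro ⟨a, ε⟩ ⟨b, δ⟩ h
  have h0 : a = b := by
    have := congrFun h 0
    simp only [traversal, add_zero, sub_zero, ite_self] at this
    exact hv this
  subst h0
  have h1 := congrFun h 1
  have hne : a + 1 ≠ a - 1 := fun h => fin_add_two_ne hk (a - 1) (by rw [sub_add_cancel, h])
  cases ε <;> cases δ <;> simp [traversal, hv.eq_iff, hne, hne.symm] at h1 ⊢

lemma cycleEdges_traversal {n k : ℕ} [NeZero k] (v : Fin k → Fin n) (a : Fin k × Bool) :
    cycleEdges (traversal v a) = cycleEdges v := by
  obtain ⟨a, ε⟩ := a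
  ext e
  simp only [cycleEdges_eq, Finset.mem_image, Finset.mem_univ, true_and]
  cases ε
  · constructor
    · rintro ⟨i, rfl⟩
      refine ⟨a - i - 1, ?_⟩
      simp only [walkEdge, traversal, Bool.false_eq_true, if_false, sub_add_cancel]
      rw [Sym2.eq_swap, sub_sub]
    · rintro ⟨i, rfl⟩
      refine ⟨a - i - 1, ?_⟩
      simp only [walkEdge, traversal, Bool.false_eq_true, if_false, sub_add_cancel]
      rw [Sym2.eq_swap, sub_sub_cancel, sub_sub, sub_sub_cancel]
  · constructor
    · rintro ⟨i, rfl⟩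
      exact ⟨a + i, by simp [walkEdge, traversal, add_assoc]⟩
    · rintro ⟨i, rfl⟩
      refine ⟨i - a, ?_⟩
      simp [walkEdge, traversal, ← add_assoc]

/-- Two cycles of the same length with the same edges are traversals of each other. -/
lemma exists_traversal_eq {n k : ℕ} [NeZero k] (hk : 3 ≤ k) {u v : Fin k → Fin n}
    (hu : Function.Injective u) (hv : Function.Injective v) (h : cycleEdges u = cycleEdges v) :
    ∃ a, traversal v a = u := by
  have hmem : ∀ i, s(u i, u (i + 1)) ∈ cycleEdges v := fun i => by
    rw [← h]
    exact mem_cycleEdges.2 ⟨i, Or.inl ⟨rfl, rfl⟩⟩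
  choose σ hσ using fun i => (mem_range_of_mem_cycleEdges (hmem i)).1
  have hσi : Function.Injective σ := fun i j hij => hu (by rw [← hσ, ← hσ, hij])
  -- the index in `v` moves by one step, forwards or backwards
  have hstep : ∀ i, σ (i + 1) = σ i + 1 ∨ σ i = σ (i + 1) + 1 := fun i => by
    obtain ⟨j, hj⟩ := mem_cycleEdges.1 (hmem i)
    rw [← hσ, ← hσ, hv.eq_iff, hv.eq_iff, hv.eq_iff, hv.eq_iff] at hj
    rcases hj with ⟨h1, h2⟩ | ⟨h1, h2⟩
    · exact Or.inl (by rw [h1, h2])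
    · exact Or.inr (by rw [h1, h2])
  rcases hstep 0 with h0 | h0
  · have hall : ∀ i, σ (i + 1) = σ i + 1 := by
      refine fin_cyclic_induction h0 fun i hi => ?_
      rcases hstep (i + 1) with h1 | h1
      · exact h1
      · exact absurd (hσi (add_right_cancel (h1.symm.trans hi))) (fin_add_two_ne hk i)
    refine ⟨(σ 0, true), funext fun i => ?_⟩
    rw [← hσ]
    simp only [traversal, if_true]
    congr 1
    refine fin_cyclic_induction (Q := fun i => σ 0 + i = σ i) (a := 0) (by simp)
      (fun i hi => ?_) i
    rw [hall, ← hi, add_assoc]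
  · have hall : ∀ i, σ i = σ (i + 1) + 1 := by
      refine fin_cyclic_induction h0 fun i hi => ?_
      rcases hstep (i + 1) with h1 | h1
      · exact absurd (hσi (h1.trans hi.symm)) (fin_add_two_ne hk i)
      · exact h1
    refine ⟨(σ 0, false), funext fun i => ?_⟩
    rw [← hσ]
    simp only [traversal, Bool.false_eq_true, if_false]
    congr 1
    refine fin_cyclic_induction (Q := fun i => σ 0 - i = σ i) (a := 0) (by simp)
      (fun i hi => ?_) i
    have := hall i
    rw [← sub_sub, hi, this, add_sub_cancel_right]

/-- The tuples of distinct vertices. -/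
def injTuples (n k : ℕ) : Finset (Fin k → Fin n) :=
  letI := Classical.decPred fun v : Fin k → Fin n => Function.Injective v
  Finset.univ.filter fun v => Function.Injective v

lemma mem_injTuples {n k : ℕ} {v : Fin k → Fin n} : v ∈ injTuples n k ↔ Function.Injective v := by
  simp [injTuples]

lemma potentialCycles_eq (n k : ℕ) : potentialCycles n k = (injTuples n k).image cycleEdges := by
  classical
  ext α
  simp [potentialCycles, injTuples]

/-- Every cycle of length `k` is represented by `2 k` tuples. -/
lemma card_cycleEdges_fiber {n k : ℕ} (hk : 3 ≤ k) {v : Fin k → Fin n}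
    (hv : Function.Injective v) :
    ((injTuples n k).filter fun u => cycleEdges u = cycleEdges v).card = 2 * k := by
  have : NeZero k := ⟨by omega⟩
  have : (injTuples n k).filter (fun u => cycleEdges u = cycleEdges v)
      = Finset.univ.image (traversal v) := by
    ext u
    simp only [Finset.mem_filter, mem_injTuples, Finset.mem_image, Finset.mem_univ, true_and]
    constructor
    · rintro ⟨hu, h⟩
      exact exists_traversal_eq hk hu hv h
    · rintro ⟨a, rfl⟩
      exact ⟨traversal_injective_right hv a, cycleEdges_traversal v a⟩
  rw [this, Finset.card_image_of_injective _ (traversal_injective_left hk hv)]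
  simp [mul_comm]

lemma sum_potentialCycles {n k : ℕ} (hk : 3 ≤ k) (F : Finset (Sym2 (Fin n)) → ℝ) :
    ∑ α ∈ potentialCycles n k, F α
      = (∑ v ∈ injTuples n k, F (cycleEdges v)) / (2 * k) := by
  have hk0 : (0 : ℝ) < 2 * k := by
    have : 0 < k := by omega
    positivity
  rw [eq_div_iff hk0.ne', potentialCycles_eq, Finset.sum_comp F cycleEdges, Finset.sum_mul]
  refine Finset.sum_congr rfl fun α hα => ?_
  obtain ⟨v, hv, rfl⟩ := Finset.mem_image.1 hα
  rw [card_cycleEdges_fiber hk (mem_injTuples.1 hv), nsmul_eq_mul]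
  push_cast
  ring

/-! ### Pairs of overlapping cycles -/

/-- The indices of the vertices of `w` which do not occur in `v`. -/
def newIndices {n k : ℕ} (v w : Fin k → Fin n) : Finset (Fin k) :=
  Finset.univ.filter fun i => w i ∉ Finset.univ.image v

lemma mem_newIndices {n k : ℕ} {v w : Fin k → Fin n} {i : Fin k} :
    i ∈ newIndices v w ↔ w i ∉ Set.range v := by
  simp [newIndices]

/-- A cycle `w` sharing an edge with the cycle `v` has more edges outside `v` than vertices outside
`v`, unless the cycles coincide: every new vertex is left by a new edge, and so is the last old
vertex before a run of new ones. -/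
lemma exists_extra_edges {n k : ℕ} [NeZero k] (hk : 3 ≤ k) {v w : Fin k → Fin n}
    (hv : Function.Injective v) (hw : Function.Injective w)
    (hvw : ¬Disjoint (cycleEdges v) (cycleEdges w)) :
    ∃ D : Finset (Fin k), D.card = (newIndices v w).card + 1 ∧
      (cycleEdges w ≠ cycleEdges v → ∀ i ∈ D, walkEdge w i ∉ cycleEdges v) := by
  by_cases hnew : (newIndices v w).Nonempty
  · have hex : ∃ i, i ∉ newIndices v w ∧ i + 1 ∈ newIndices v w := by
      by_contra! hcon
      obtain ⟨e, he, he'⟩ := Finset.not_disjoint_iff.1 hvw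
      rw [cycleEdges_eq w] at he'
      obtain ⟨i, -, rfl⟩ := Finset.mem_image.1 he'
      have hi : i ∉ newIndices v w := fun h =>
        mem_newIndices.1 h (mem_range_of_mem_cycleEdges he).1
      obtain ⟨j, hj⟩ := hnew
      exact fin_cyclic_induction (Q := fun i => i ∉ newIndices v w) hi hcon j hj
    obtain ⟨i, hi, hi'⟩ := hex
    refine ⟨insert i (newIndices v w), Finset.card_insert_of_notMem hi, fun _ j hj hmem => ?_⟩
    have := mem_range_of_mem_cycleEdges hmem
    rcases Finset.mem_insert.1 hj with rfl | hj
    · exact mem_newIndices.1 hi' this.2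
    · exact mem_newIndices.1 hj this.1
  · rw [Finset.not_nonempty_iff_eq_empty] at hnew
    rw [hnew]
    by_cases heq : cycleEdges w = cycleEdges v
    · exact ⟨{0}, by simp, fun h => absurd heq h⟩
    · have : ∃ i, walkEdge w i ∉ cycleEdges v := by
        by_contra! hcon
        refine heq (Finset.eq_of_subset_of_card_le ?_ ?_)
        · rw [cycleEdges_eq w]
          exact Finset.image_subset_iff.2 fun i _ => hcon i
        · rw [card_cycleEdges hk hv, card_cycleEdges hk hw]
      obtain ⟨i, hi⟩ := this
      exact ⟨{i}, by simp, fun _ j hj => by rwa [Finset.mem_singleton.1 hj]⟩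

/-- Both kinds of terms in `overlapSum` are bounded by the product over the edges of the first cycle
and over some further edges of the second one, one more than there are new vertices. -/
lemma exists_prod_overlap_le {n k : ℕ} [NeZero k] (hk : 3 ≤ k) {v w : Fin k → Fin n}
    (hv : Function.Injective v) (hw : Function.Injective w)
    (hvw : ¬Disjoint (cycleEdges v) (cycleEdges w)) {p : Sym2 (Fin n) → ℝ}
    (h0 : ∀ e, 0 ≤ p e) (h1 : ∀ e, p e ≤ 1) :
    ∃ D : Finset (Fin k), D.card = (newIndices v w).card + 1 ∧
      ((∏ e ∈ cycleEdges v, p e) * (∏ e ∈ cycleEdges w, p e) +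
          if cycleEdges w = cycleEdges v then 0 else ∏ e ∈ cycleEdges v ∪ cycleEdges w, p e)
        ≤ 2 * ((∏ i, p (walkEdge v i)) * ∏ i ∈ D, p (walkEdge w i)) := by
  obtain ⟨D, hD, hDe⟩ := exists_extra_edges hk hv hw hvw
  refine ⟨D, hD, ?_⟩
  have hpv : 0 ≤ ∏ i, p (walkEdge v i) := Finset.prod_nonneg fun i _ => h0 _
  have hpD : 0 ≤ ∏ i ∈ D, p (walkEdge w i) := Finset.prod_nonneg fun i _ => h0 _
  have hb1 : ∏ e ∈ cycleEdges w, p e ≤ ∏ i ∈ D, p (walkEdge w i) := by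
    rw [prod_cycleEdges hk hw]
    exact Finset.prod_le_prod_of_subset_of_le_one (Finset.subset_univ _) (fun _ _ => h0 _)
      fun _ _ _ => h1 _
  rw [two_mul]
  refine add_le_add ?_ ?_
  · rw [prod_cycleEdges hk hv]
    exact mul_le_mul_of_nonneg_left hb1 hpv
  · split_ifs with heq
    · exact mul_nonneg hpv hpD
    · rw [← prod_cycleEdges hk hv, ← Finset.prod_image (f := p) (g := walkEdge w) (s := D)
        (walkEdge_injective hk hw).injOn, ← Finset.prod_union]
      · refine Finset.prod_le_prod_of_subset_of_le_one (Finset.union_subset_union_right ?_)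
          (fun _ _ => h0 _) fun _ _ _ => h1 _
        rw [cycleEdges_eq]
        exact Finset.image_subset_image (Finset.subset_univ _)
      · refine Finset.disjoint_left.2 fun e he he' => ?_
        obtain ⟨i, hi, rfl⟩ := Finset.mem_image.1 he'
        exact hDe heq i hi he

/-- A tuple `w` with `u` vertices outside `v` is weighted by `n ^ (-u)`: the weights add up to a
bounded number, since every entry of `w` either is one of the `k` entries of `v` or costs a factor
`1 / n`. -/
lemma sum_newIndices_le {n k : ℕ} (v : Fin k → Fin n) :
    ∑ w : Fin k → Fin n, ((n : ℝ)⁻¹) ^ (newIndices v w).card ≤ ((k : ℝ) + 1) ^ k := by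
  have h1 : ∀ w : Fin k → Fin n, ((n : ℝ)⁻¹) ^ (newIndices v w).card
      = ∏ i, if w i ∈ Finset.univ.image v then 1 else (n : ℝ)⁻¹ := fun w => by
    rw [Finset.prod_ite, Finset.prod_const_one, one_mul, Finset.prod_const]
    rfl
  simp only [h1]
  have h2 := Finset.prod_univ_sum (fun _ : Fin k => (Finset.univ : Finset (Fin n)))
    fun _ x => if x ∈ Finset.univ.image v then (1 : ℝ) else (n : ℝ)⁻¹
  rw [Fintype.piFinset_univ] at h2
  rw [← h2, Finset.prod_const, Finset.card_univ, Fintype.card_fin]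
  refine pow_le_pow_left₀ (Finset.sum_nonneg fun x _ => by split_ifs <;> positivity) ?_ k
  rw [Finset.sum_ite, Finset.sum_const, Finset.sum_const, nsmul_eq_mul, nsmul_eq_mul, mul_one]
  refine add_le_add ?_ ?_
  · have : (Finset.univ.filter fun x => x ∈ Finset.univ.image v).card ≤ k := by
      refine (Finset.card_le_card (t := Finset.univ.image v) fun x hx => ?_).trans ?_
      · exact (Finset.mem_filter.1 hx).2
      · exact Finset.card_image_le.trans (by simp)
    exact_mod_cast this
  · have : (Finset.univ.filter fun x => x ∉ Finset.univ.image v).card ≤ n :=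
      (Finset.card_le_univ _).trans (by simp)
    rw [← div_eq_mul_inv]
    exact div_le_one_of_le₀ (by exact_mod_cast this) (Nat.cast_nonneg n)

/-! ### The overlap term for given weights -/

lemma sum_potentialCycles_le {n k : ℕ} (hk : 3 ≤ k) {F : Finset (Sym2 (Fin n)) → ℝ}
    (hF : ∀ α, 0 ≤ F α) :
    ∑ α ∈ potentialCycles n k, F α ≤ ∑ v ∈ injTuples n k, F (cycleEdges v) := by
  rw [sum_potentialCycles hk]
  have : (3 : ℝ) ≤ k := by exact_mod_cast hk
  exact div_le_self (Finset.sum_nonneg fun _ _ => hF _) (by linarith)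

/-- A polynomial in the weights which dominates the overlap term of the Chen–Stein bound: each
vertex of a pair of overlapping cycles contributes at most the fourth power of its weight. -/
def overlapMoment {n : ℕ} (k : ℕ) (w : Fin n → ℝ) : ℝ :=
  ∑ v : Fin k → Fin n, ∑ v' : Fin k → Fin n, ((n : ℝ)⁻¹) ^ (newIndices v v').card *
    ∏ x ∈ Finset.univ.image v ∪ Finset.univ.image v', max 1 (w x) ^ 4

lemma one_le_prod_of_one_le {ι : Type*} (s : Finset ι) {f : ι → ℝ} (hf : ∀ i, 1 ≤ f i) :
    1 ≤ ∏ i ∈ s, f i := by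
  rw [← Finset.prod_const_one (s := s)]
  exact Finset.prod_le_prod (fun _ _ => zero_le_one) fun i _ => hf i

lemma prod_shift {n k : ℕ} [NeZero k] (y : Fin n → ℝ) (v : Fin k → Fin n) :
    ∏ i, y (v i) * y (v (i + 1)) = ∏ i, y (v i) ^ 2 := by
  have h : ∏ i, y (v (i + 1)) = ∏ i, y (v i) :=
    Equiv.prod_comp (Equiv.addRight (1 : Fin k)) fun i => y (v i)
  rw [Finset.prod_mul_distrib, h, ← Finset.prod_mul_distrib]
  exact Finset.prod_congr rfl fun i _ => (sq _).symm

lemma prod_sq_le_prod_union {n k : ℕ} {y : Fin n → ℝ} (hy : ∀ x, 1 ≤ y x) {v v' : Fin k → Fin n}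
    (hv : Function.Injective v) (hv' : Function.Injective v') :
    (∏ i, y (v i) ^ 2) * ∏ i, y (v' i) ^ 2
      ≤ ∏ x ∈ Finset.univ.image v ∪ Finset.univ.image v', y x ^ 4 := by
  have h1 : ∀ x, 1 ≤ y x ^ 2 := fun x => one_le_pow₀ (hy x)
  have key : ∀ (t : Finset (Fin n)) (u : Fin k → Fin n), Function.Injective u →
      Finset.univ.image u ⊆ t → ∏ i, y (u i) ^ 2 ≤ ∏ x ∈ t, y x ^ 2 := by
    intro t u hu hut
    rw [← Finset.prod_image (f := fun x => y x ^ 2) (g := u) (s := Finset.univ) hu.injOn,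
      ← Finset.prod_sdiff hut]
    refine le_mul_of_one_le_left (Finset.prod_nonneg fun x _ => by positivity) ?_
    exact one_le_prod_of_one_le _ h1
  have h4 : ∀ x, y x ^ 4 = y x ^ 2 * y x ^ 2 := fun x => by ring
  simp only [h4, Finset.prod_mul_distrib]
  exact mul_le_mul (key _ v hv Finset.subset_union_left) (key _ v' hv' Finset.subset_union_right)
    (Finset.prod_nonneg fun x _ => by positivity) (Finset.prod_nonneg fun x _ => by positivity)

lemma overlapSum_le {n k : ℕ} (hk : 3 ≤ k) {w : Fin n → ℝ} (hw : ∀ i, 0 < w i) {c : ℝ}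
    (hc : 1 ≤ c) (hp : ∀ i j, edgeProb w i j ≤ c * (n : ℝ)⁻¹ * (w i * w j)) :
    overlapSum (symEdgeProb w) (potentialCycles n k)
      ≤ 2 * c ^ (2 * k + 1) * ((n : ℝ)⁻¹ ^ (k + 1) * overlapMoment k w) := by
  classical
  have : NeZero k := ⟨by omega⟩
  have h0 := symEdgeProb_nonneg hw
  have h1 := symEdgeProb_le_one hw
  set p := symEdgeProb w with hpdef
  set y : Fin n → ℝ := fun x => max 1 (w x) with hy
  have hy1 : ∀ x, 1 ≤ y x := fun x => le_max_left _ _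
  have hyw : ∀ x, w x ≤ y x := fun x => le_max_right _ _
  have hn : (0 : ℝ) ≤ (n : ℝ)⁻¹ := by positivity
  have hp' : ∀ (u : Fin k → Fin n) i,
      p (walkEdge u i) ≤ c * (n : ℝ)⁻¹ * (y (u i) * y (u (i + 1))) := fun u i => by
    refine (hp _ _).trans ?_
    have := hw (u i)
    have := hw (u (i + 1))
    have := hyw (u i)
    have := hyw (u (i + 1))
    gcongr
  have ht : ∀ α β : Finset (Sym2 (Fin n)), 0 ≤ if ¬Disjoint α β then
      ((∏ e ∈ α, p e) * (∏ e ∈ β, p e) + if β = α then 0 else ∏ e ∈ α ∪ β, p e) else 0 := by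
    intro α β
    have := fun s : Finset (Sym2 (Fin n)) => Finset.prod_nonneg fun e (_ : e ∈ s) => h0 e
    by_cases hd : Disjoint α β
    · rw [if_neg (not_not.2 hd)]
    · rw [if_pos hd]
      refine add_nonneg (mul_nonneg (this _) (this _)) ?_
      split_ifs
      exacts [le_rfl, this _]
  rw [overlapSum]
  simp only [Finset.sum_filter]
  refine (sum_potentialCycles_le hk fun α => Finset.sum_nonneg fun β _ => ht α β).trans ?_
  rw [overlapMoment, Finset.mul_sum, Finset.mul_sum]
  refine (Finset.sum_le_sum fun v hv => ?_).trans
    (Finset.sum_le_sum_of_subset_of_nonneg (Finset.subset_univ (injTuples n k)) fun v _ _ => ?_)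
  swap
  · refine mul_nonneg (by positivity) (mul_nonneg (by positivity)
      (Finset.sum_nonneg fun v' _ => mul_nonneg (by positivity)
        (Finset.prod_nonneg fun x _ => by positivity)))
  refine (sum_potentialCycles_le hk fun β => ht _ β).trans ?_
  rw [Finset.mul_sum, Finset.mul_sum]
  refine (Finset.sum_le_sum fun v' hv' => ?_).trans
    (Finset.sum_le_sum_of_subset_of_nonneg (Finset.subset_univ (injTuples n k)) fun v' _ _ => ?_)
  swap
  · exact mul_nonneg (by positivity) (mul_nonneg (by positivity) (mul_nonneg (by positivity)
        (Finset.prod_nonneg fun x _ => by positivity)))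
  have hvi := mem_injTuples.1 hv
  have hvi' := mem_injTuples.1 hv'
  have hprod : 0 ≤ ∏ x ∈ Finset.univ.image v ∪ Finset.univ.image v', y x ^ 4 :=
    Finset.prod_nonneg fun x _ => by positivity
  by_cases hd : Disjoint (cycleEdges v) (cycleEdges v')
  · rw [if_neg (not_not.2 hd)]
    exact mul_nonneg (by positivity) (mul_nonneg (by positivity) (mul_nonneg (by positivity) hprod))
  rw [if_pos hd]
  obtain ⟨D, hD, hle⟩ := exists_prod_overlap_le hk hvi hvi' hd h0 h1
  refine hle.trans ?_
  have hb1 : ∏ i, p (walkEdge v i) ≤ (c * (n : ℝ)⁻¹) ^ k * ∏ i, y (v i) ^ 2 := by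
    refine (Finset.prod_le_prod (fun i _ => h0 _) fun i _ => hp' v i).trans (le_of_eq ?_)
    rw [Finset.prod_mul_distrib, prod_shift, Finset.prod_const, Finset.card_univ, Fintype.card_fin]
  have hyy : ∀ i, 1 ≤ y (v' i) * y (v' (i + 1)) := fun i =>
    one_le_mul_of_one_le_of_one_le (hy1 _) (hy1 _)
  have hb2 : ∏ i ∈ D, p (walkEdge v' i) ≤ (c * (n : ℝ)⁻¹) ^ D.card * ∏ i, y (v' i) ^ 2 := by
    refine (Finset.prod_le_prod (fun i _ => h0 _) fun i _ => hp' v' i).trans ?_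
    rw [Finset.prod_mul_distrib, Finset.prod_const, ← prod_shift,
      ← Finset.prod_sdiff (Finset.subset_univ D)]
    refine mul_le_mul_of_nonneg_left ?_ (by positivity)
    refine le_mul_of_one_le_left
      (Finset.prod_nonneg fun i _ => zero_le_one.trans (hyy i)) ?_
    exact one_le_prod_of_one_le _ hyy
  have hcard : (newIndices v v').card ≤ k := (Finset.card_le_univ _).trans (by simp)
  calc 2 * ((∏ i, p (walkEdge v i)) * ∏ i ∈ D, p (walkEdge v' i))
      ≤ 2 * (((c * (n : ℝ)⁻¹) ^ k * ∏ i, y (v i) ^ 2)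
          * ((c * (n : ℝ)⁻¹) ^ D.card * ∏ i, y (v' i) ^ 2)) := by
        refine mul_le_mul_of_nonneg_left (mul_le_mul hb1 hb2
          (Finset.prod_nonneg fun i _ => h0 _) ?_) zero_le_two
        exact mul_nonneg (by positivity) (Finset.prod_nonneg fun i _ => by positivity)
    _ = 2 * c ^ (k + D.card) * ((n : ℝ)⁻¹ ^ (k + D.card)
          * ((∏ i, y (v i) ^ 2) * ∏ i, y (v' i) ^ 2)) := by
        rw [pow_add, pow_add, mul_pow, mul_pow]
        ring
    _ ≤ 2 * c ^ (2 * k + 1) * ((n : ℝ)⁻¹ ^ (k + D.card)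
          * ∏ x ∈ Finset.univ.image v ∪ Finset.univ.image v', y x ^ 4) := by
        refine mul_le_mul ?_ (mul_le_mul_of_nonneg_left
          (prod_sq_le_prod_union hy1 hvi hvi') (by positivity)) ?_ (by positivity)
        · exact mul_le_mul_of_nonneg_left (pow_le_pow_right₀ hc (by omega)) zero_le_two
        · exact mul_nonneg (by positivity) (mul_nonneg
            (Finset.prod_nonneg fun i _ => by positivity)
            (Finset.prod_nonneg fun i _ => by positivity))
    _ = _ := by
        rw [hD, show k + ((newIndices v v').card + 1) = (k + 1) + (newIndices v v').card by ring,
          pow_add]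
        ring

/-! ### The conditional mean of the number of cycles -/

/-- Summing over all tuples a product of vertex factors and a factor depending on two entries. -/
lemma sum_tuples_two_points {n k : ℕ} (a : Fin n → ℝ) (g : Fin n → Fin n → ℝ) {i j : Fin k}
    (hij : i ≠ j) :
    ∑ v : Fin k → Fin n, g (v i) (v j) * ∏ l, a (v l)
      = (∑ x, ∑ y, g x y * (a x * a y)) * (∑ x, a x) ^ (k - 2) := by
  classical
  have hone : ∀ x y, ∑ v : Fin k → Fin n,
        (if v i = x ∧ v j = y then ∏ l, a (v l) else 0)
      = a x * a y * (∑ x, a x) ^ (k - 2) := by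
    intro x y
    set b : Fin k → Fin n → ℝ := fun l z =>
      if l = i then (if z = x then a z else 0) else if l = j then (if z = y then a z else 0)
        else a z with hb
    have h1 : ∀ v : Fin k → Fin n,
        (if v i = x ∧ v j = y then ∏ l, a (v l) else 0) = ∏ l, b l (v l) := by
      intro v
      split_ifs with h
      · refine Finset.prod_congr rfl fun l _ => ?_
        simp only [hb]
        split_ifs with h2 h3 h4 h5
        · rfl
        · exact absurd (h2 ▸ h.1) h3
        · rfl
        · exact absurd (h4 ▸ h.2) h5
        · rfl
      · rw [not_and_or] at h
        rcases h with h | h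
        · exact (Finset.prod_eq_zero (Finset.mem_univ i) (by simp [hb, h])).symm
        · exact (Finset.prod_eq_zero (Finset.mem_univ j) (by simp [hb, h, hij.symm])).symm
    simp only [h1]
    have h2 := Finset.prod_univ_sum (fun _ : Fin k => (Finset.univ : Finset (Fin n))) b
    rw [Fintype.piFinset_univ] at h2
    have hj : j ∈ Finset.univ.erase i := Finset.mem_erase.2 ⟨hij.symm, Finset.mem_univ j⟩
    rw [← h2, ← Finset.mul_prod_erase _ _ (Finset.mem_univ i), ← Finset.mul_prod_erase _ _ hj,
      ← mul_assoc]
    congr 1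
    · simp [hb, hij.symm]
    · rw [Finset.prod_congr rfl (g := fun _ => ∑ x, a x), Finset.prod_const,
        Finset.card_erase_of_mem hj, Finset.card_erase_of_mem (Finset.mem_univ i),
        Finset.card_univ, Fintype.card_fin, Nat.sub_sub]
      intro l hl
      have hl1 := Finset.ne_of_mem_erase hl
      have hl2 := Finset.ne_of_mem_erase (Finset.mem_of_mem_erase hl)
      simp [hb, hl1, hl2]
  have h2 : ∀ v : Fin k → Fin n, g (v i) (v j) * ∏ l, a (v l)
      = ∑ x, ∑ y, g x y * (if v i = x ∧ v j = y then ∏ l, a (v l) else 0) := by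
    intro v
    rw [Finset.sum_eq_single (v i) (fun x _ hx => ?_) (by simp)]
    · rw [Finset.sum_eq_single (v j) (fun y _ hy => ?_) (by simp)]
      · simp
      · rw [if_neg fun h => hy h.2.symm, mul_zero]
    · exact Finset.sum_eq_zero fun y _ => by rw [if_neg fun h => hx h.1.symm, mul_zero]
  simp only [h2]
  rw [Finset.sum_comm, Finset.sum_mul]
  refine Finset.sum_congr rfl fun x _ => ?_
  rw [Finset.sum_comm, Finset.sum_mul]
  refine Finset.sum_congr rfl fun y _ => ?_
  rw [← Finset.mul_sum, hone]
  ring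

lemma sum_tuples_prod {n k : ℕ} (a : Fin n → ℝ) :
    ∑ v : Fin k → Fin n, ∏ l, a (v l) = (∑ x, a x) ^ k := by
  have h2 := Finset.prod_univ_sum (fun _ : Fin k => (Finset.univ : Finset (Fin n))) fun _ x => a x
  rw [Fintype.piFinset_univ] at h2
  rw [← h2, Finset.prod_const, Finset.card_univ, Fintype.card_fin]

lemma sum_not_injective_le {n k : ℕ} (w : Fin n → ℝ) :
    ∑ v ∈ Finset.univ \ injTuples n k, ∏ l, w (v l) ^ 2
      ≤ (k : ℝ) ^ 2 * ((∑ x, w x ^ 4) * (∑ x, w x ^ 2) ^ (k - 2)) := by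
  classical
  have hnn : ∀ v : Fin k → Fin n, 0 ≤ ∏ l, w (v l) ^ 2 := fun v =>
    Finset.prod_nonneg fun l _ => sq_nonneg _
  have hpair : ∀ i j : Fin k, i ≠ j →
      ∑ v : Fin k → Fin n, (if v i = v j then (1 : ℝ) else 0) * ∏ l, w (v l) ^ 2
        = (∑ x, w x ^ 4) * (∑ x, w x ^ 2) ^ (k - 2) := by
    intro i j hij
    rw [sum_tuples_two_points (fun x => w x ^ 2) (fun x y => if x = y then 1 else 0) hij]
    congr 1
    refine Finset.sum_congr rfl fun x _ => ?_
    rw [Finset.sum_eq_single x (fun y _ hy => ?_) (by simp)]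
    · simp only [if_true]
      ring
    · rw [if_neg hy.symm, zero_mul]
  have hA : 0 ≤ (∑ x, w x ^ 4) * (∑ x, w x ^ 2) ^ (k - 2) :=
    mul_nonneg (Finset.sum_nonneg fun x _ => by positivity)
      (pow_nonneg (Finset.sum_nonneg fun x _ => by positivity) _)
  calc ∑ v ∈ Finset.univ \ injTuples n k, ∏ l, w (v l) ^ 2
      ≤ ∑ v : Fin k → Fin n, ∑ i, ∑ j,
          if i = j then 0 else (if v i = v j then (1 : ℝ) else 0) * ∏ l, w (v l) ^ 2 := by
        have hterm : ∀ (v : Fin k → Fin n) (i j : Fin k), 0 ≤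
            if i = j then 0 else (if v i = v j then (1 : ℝ) else 0) * ∏ l, w (v l) ^ 2 := by
          intro v i j
          have := hnn v
          split_ifs <;> simp [this]
        refine (Finset.sum_le_sum fun v hv => ?_).trans
          (Finset.sum_le_sum_of_subset_of_nonneg
            (Finset.subset_univ (Finset.univ \ injTuples n k)) fun v _ _ =>
              Finset.sum_nonneg fun i _ => Finset.sum_nonneg fun j _ => hterm v i j)
        have hv' : ¬Function.Injective v := fun h =>
          (Finset.mem_sdiff.1 hv).2 (mem_injTuples.2 h)
        simp only [Function.Injective, not_forall] at hv'
        obtain ⟨i, j, hij, hne⟩ := hv'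
        refine le_trans ?_ (Finset.single_le_sum (f := fun i => ∑ j,
          if i = j then 0 else (if v i = v j then (1 : ℝ) else 0) * ∏ l, w (v l) ^ 2)
          (fun i _ => Finset.sum_nonneg fun j _ => hterm v i j) (Finset.mem_univ i))
        refine le_trans ?_ (Finset.single_le_sum (f := fun j =>
          if i = j then 0 else (if v i = v j then (1 : ℝ) else 0) * ∏ l, w (v l) ^ 2)
          (fun j _ => hterm v i j) (Finset.mem_univ j))
        simp [hne, hij]
    _ = ∑ i : Fin k, ∑ j : Fin k, if i = j then 0 else
          (∑ x, w x ^ 4) * (∑ x, w x ^ 2) ^ (k - 2) := by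
        rw [Finset.sum_comm]
        refine Finset.sum_congr rfl fun i _ => ?_
        rw [Finset.sum_comm]
        refine Finset.sum_congr rfl fun j _ => ?_
        split_ifs with hij
        · simp
        · exact hpair i j hij
    _ ≤ ∑ i : Fin k, ∑ j : Fin k, (∑ x, w x ^ 4) * (∑ x, w x ^ 2) ^ (k - 2) := by
        refine Finset.sum_le_sum fun i _ => Finset.sum_le_sum fun j _ => ?_
        split_ifs
        · exact hA
        · exact le_rfl
    _ = _ := by
        simp only [Finset.sum_const, Finset.card_univ, Fintype.card_fin, nsmul_eq_mul]
        ring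

lemma prod_sub_prod_div_le {ι : Type*} (s : Finset ι) {t : ι → ℝ} (ht : ∀ i ∈ s, 0 ≤ t i) :
    ∏ i ∈ s, t i - ∏ i ∈ s, t i / (1 + t i) ≤ (∑ i ∈ s, t i) * ∏ i ∈ s, t i := by
  have h1 : Real.exp (-∑ i ∈ s, t i) ≤ ∏ i ∈ s, (1 + t i)⁻¹ := by
    rw [← Finset.sum_neg_distrib, Real.exp_sum]
    refine Finset.prod_le_prod (fun i _ => (Real.exp_pos _).le) fun i hi => ?_
    rw [Real.exp_neg]
    have := Real.add_one_le_exp (t i)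
    have := ht i hi
    exact inv_anti₀ (by linarith) (by linarith)
  have h2 := Real.add_one_le_exp (-∑ i ∈ s, t i)
  have h3 : 0 ≤ ∏ i ∈ s, t i := Finset.prod_nonneg ht
  simp only [div_eq_mul_inv, Finset.prod_mul_distrib]
  nlinarith

/-- The conditional mean of the number of cycles of length `k`, given the weights `w`. -/
def condMean {n : ℕ} (k : ℕ) (w : Fin n → ℝ) : ℝ :=
  ∑ α ∈ potentialCycles n k, ∏ e ∈ α, symEdgeProb w e

lemma condMean_eq {n k : ℕ} [NeZero k] (hk : 3 ≤ k) (w : Fin n → ℝ) :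
    condMean k w = (∑ v ∈ injTuples n k, ∏ i, edgeProb w (v i) (v (i + 1))) / (2 * k) := by
  rw [condMean, sum_potentialCycles hk]
  congr 1
  refine Finset.sum_congr rfl fun v hv => ?_
  rw [prod_cycleEdges hk (mem_injTuples.1 hv)]
  rfl

lemma edgeProb_eq_div {n : ℕ} {w : Fin n → ℝ} (hL : 0 < ∑ l, w l) {i j : Fin n} (hij : i ≠ j) :
    edgeProb w i j = w i * w j / (∑ l, w l) / (1 + w i * w j / ∑ l, w l) := by
  rw [edgeProb, if_neg hij, div_div, mul_add, mul_div_cancel₀ _ hL.ne', mul_one]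

/-- The conditional mean is close to its value for the product edge probabilities `w i * w j / L`,
summed over all tuples instead of the tuples of distinct vertices. -/
lemma abs_condMean_sub_le {n k : ℕ} (hk : 3 ≤ k) {w : Fin n → ℝ} (hw : ∀ i, 0 < w i)
    (hL : 0 < ∑ l, w l) :
    |condMean k w - ((∑ x, w x ^ 2) / ∑ l, w l) ^ k / (2 * k)|
      ≤ (k : ℝ) ^ 2 * ((∑ x, w x ^ 4) * (∑ x, w x ^ 2) ^ (k - 2)) / (∑ l, w l) ^ k
        + k * ((∑ x, w x ^ 4) * (∑ x, w x ^ 2) ^ (k - 1)) / (∑ l, w l) ^ (k + 1) := by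
  classical
  have : NeZero k := ⟨by omega⟩
  set L := ∑ l, w l with hLdef
  set S2 := ∑ x, w x ^ 2 with hS2
  set S4 := ∑ x, w x ^ 4 with hS4
  have hS2n : 0 ≤ S2 := Finset.sum_nonneg fun x _ => by positivity
  have hS4n : 0 ≤ S4 := Finset.sum_nonneg fun x _ => by positivity
  set t : (Fin k → Fin n) → Fin k → ℝ := fun v i => w (v i) * w (v (i + 1)) / L with ht
  have ht0 : ∀ v i, 0 ≤ t v i := fun v i =>
    div_nonneg (mul_nonneg (hw _).le (hw _).le) hL.le
  have hprod : ∀ v, ∏ i, t v i = (∏ i, w (v i) ^ 2) / L ^ k := fun v => by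
    simp only [ht]
    rw [Finset.prod_div_distrib, prod_shift, Finset.prod_const, Finset.card_univ, Fintype.card_fin]
  have hall : ∑ v : Fin k → Fin n, ∏ i, t v i = (S2 / L) ^ k := by
    simp only [hprod]
    rw [← Finset.sum_div, sum_tuples_prod fun x => w x ^ 2, div_pow]
  have hedge : ∀ v ∈ injTuples n k,
      ∏ i, edgeProb w (v i) (v (i + 1)) = ∏ i, t v i / (1 + t v i) := fun v hv => by
    refine Finset.prod_congr rfl fun i _ => edgeProb_eq_div hL fun h => ?_
    have h1 := mem_injTuples.1 hv h
    exact fin_add_two_ne hk i (by rw [← h1, ← h1])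
  have hnon : ∑ v ∈ Finset.univ \ injTuples n k, ∏ i, t v i
      ≤ (k : ℝ) ^ 2 * (S4 * S2 ^ (k - 2)) / L ^ k := by
    simp only [hprod]
    rw [← Finset.sum_div]
    exact div_le_div_of_nonneg_right (sum_not_injective_le w) (by positivity)
  have hnon0 : 0 ≤ ∑ v ∈ Finset.univ \ injTuples n k, ∏ i, t v i :=
    Finset.sum_nonneg fun v _ => Finset.prod_nonneg fun i _ => ht0 v i
  have hcauchy : (∑ x, w x ^ 3) ^ 2 ≤ S2 * S4 := by
    have := Finset.sum_mul_sq_le_sq_mul_sq Finset.univ w fun x => w x ^ 2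
    calc (∑ x, w x ^ 3) ^ 2 = (∑ x, w x * w x ^ 2) ^ 2 := by
          congr 1; exact Finset.sum_congr rfl fun x _ => by ring
      _ ≤ (∑ x, w x ^ 2) * ∑ x, (w x ^ 2) ^ 2 := this
      _ = S2 * S4 := by
          congr 1; exact Finset.sum_congr rfl fun x _ => by ring
  have htwo : ∀ i : Fin k, ∑ v : Fin k → Fin n, t v i * ∏ j, t v j
      ≤ S4 * S2 ^ (k - 1) / L ^ (k + 1) := fun i => by
    have hne : i ≠ i + 1 := fun h => fin_add_two_ne hk i (by rw [← h, ← h])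
    have h1 : ∀ v : Fin k → Fin n, t v i * ∏ j, t v j
        = (w (v i) * w (v (i + 1)) * ∏ l, w (v l) ^ 2) / L ^ (k + 1) := fun v => by
      rw [hprod, pow_succ]
      simp only [ht]
      field_simp
    simp only [h1]
    rw [← Finset.sum_div, sum_tuples_two_points (fun x => w x ^ 2) (fun x y => w x * w y) hne]
    refine div_le_div_of_nonneg_right ?_ (by positivity)
    have h2 : ∑ x, ∑ y, w x * w y * (w x ^ 2 * w y ^ 2) = (∑ x, w x ^ 3) ^ 2 := by
      rw [sq, Finset.sum_mul_sum]
      exact Finset.sum_congr rfl fun x _ => Finset.sum_congr rfl fun y _ => by ring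
    rw [h2, show k - 1 = (k - 2) + 1 by omega, pow_succ]
    calc (∑ x, w x ^ 3) ^ 2 * S2 ^ (k - 2) ≤ (S2 * S4) * S2 ^ (k - 2) :=
          mul_le_mul_of_nonneg_right hcauchy (by positivity)
      _ = _ := by ring
  have hinj : ∑ v ∈ injTuples n k, (∏ i, t v i - ∏ i, t v i / (1 + t v i))
      ≤ k * (S4 * S2 ^ (k - 1)) / L ^ (k + 1) := by
    calc ∑ v ∈ injTuples n k, (∏ i, t v i - ∏ i, t v i / (1 + t v i))
        ≤ ∑ v ∈ injTuples n k, (∑ i, t v i) * ∏ i, t v i :=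
          Finset.sum_le_sum fun v _ => prod_sub_prod_div_le _ fun i _ => ht0 v i
      _ ≤ ∑ v : Fin k → Fin n, (∑ i, t v i) * ∏ i, t v i :=
          Finset.sum_le_sum_of_subset_of_nonneg (Finset.subset_univ _) fun v _ _ =>
            mul_nonneg (Finset.sum_nonneg fun i _ => ht0 v i)
              (Finset.prod_nonneg fun i _ => ht0 v i)
      _ = ∑ i, ∑ v : Fin k → Fin n, t v i * ∏ j, t v j := by
          rw [Finset.sum_comm]
          exact Finset.sum_congr rfl fun v _ => Finset.sum_mul _ _ _
      _ ≤ ∑ _i : Fin k, S4 * S2 ^ (k - 1) / L ^ (k + 1) :=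
          Finset.sum_le_sum fun i _ => htwo i
      _ = _ := by
          rw [Finset.sum_const, Finset.card_univ, Fintype.card_fin, nsmul_eq_mul]
          ring
  have hinj0 : 0 ≤ ∑ v ∈ injTuples n k, (∏ i, t v i - ∏ i, t v i / (1 + t v i)) := by
    refine Finset.sum_nonneg fun v _ => sub_nonneg.2 (Finset.prod_le_prod (fun i _ => ?_)
      fun i _ => ?_)
    · have := ht0 v i
      positivity
    · exact div_le_self (ht0 v i) (by linarith [ht0 v i])
  have hk1 : (1 : ℝ) ≤ 2 * k := by
    have : (3 : ℝ) ≤ k := by exact_mod_cast hk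
    linarith
  have hdiff : (S2 / L) ^ k - ∑ v ∈ injTuples n k, ∏ i, edgeProb w (v i) (v (i + 1))
      = ∑ v ∈ Finset.univ \ injTuples n k, ∏ i, t v i
        + ∑ v ∈ injTuples n k, (∏ i, t v i - ∏ i, t v i / (1 + t v i)) := by
    rw [← hall, Finset.sum_congr rfl hedge, Finset.sum_sub_distrib,
      ← Finset.sum_sdiff (Finset.subset_univ (injTuples n k))]
    ring
  rw [condMean_eq hk, ← sub_div, abs_div, abs_sub_comm, hdiff,
    abs_of_nonneg (add_nonneg hnon0 hinj0), abs_of_pos (by linarith : (0 : ℝ) < 2 * k)]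
  exact (div_le_self (add_nonneg hnon0 hinj0) hk1).trans (add_le_add hnon hinj)

/-! ### The conditional Poisson approximation -/

/-- The conditional expectation of `h` of the number of cycles of length `k`, given the weights
`w`. -/
def condExpect {n : ℕ} (k : ℕ) (h : ℕ → ℝ) (w : Fin n → ℝ) : ℝ :=
  ∑ H : SimpleGraph (Fin n), graphProb w H * h (numCycles k H)

/-- The Poisson distribution need not have the conditional mean as its parameter: the difference
only enters through the bound of the solution of the Stein equation. -/
lemma abs_condExpect_sub_le_stein {n k : ℕ} (hk : 3 ≤ k) {w : Fin n → ℝ} (hw : ∀ i, 0 < w i)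
    (r : NNReal) {h : ℕ → ℝ} (hh : ∀ j, |h j| ≤ 1) :
    |condExpect k h w - ∫ m, h m ∂poissonMeasure r|
      ≤ 2 * Real.exp r * |r - condMean k w|
        + 2 * (2 * Real.exp r) * overlapSum (symEdgeProb w) (potentialCycles n k) := by
  have : NeZero k := ⟨by omega⟩
  obtain ⟨f, hf, hfe⟩ := exists_stein_solution r hh
  set K := 2 * Real.exp (r : ℝ) with hK
  have h0 := symEdgeProb_nonneg hw
  have h1 := symEdgeProb_le_one hw
  set p := symEdgeProb w with hp
  set N := countSubsets (potentialCycles n k) with hN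
  have hne : ∀ α ∈ potentialCycles n k, α.Nonempty := fun α hα => by
    rw [potentialCycles_eq] at hα
    obtain ⟨v, -, rfl⟩ := Finset.mem_image.1 hα
    exact ⟨_, mem_cycleEdges.2 ⟨0, Or.inl ⟨rfl, rfl⟩⟩⟩
  have hT : condExpect k h w = subsetExp p fun s => h (N s) := by
    rw [condExpect, hp, ← sum_graphProb_mul]
    simp only [numCycles_eq, hN]
  have e1 : condExpect k h w - ∫ m, h m ∂poissonMeasure r
      = subsetExp p (fun s => (r - condMean k w) * f (N s + 1))
        + subsetExp p fun s => condMean k w * f (N s + 1) - N s * f (N s) := by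
    rw [hT, ← subsetExp_const p (∫ m, h m ∂poissonMeasure r), ← subsetExp_sub, ← subsetExp_add]
    congr 1
    ext s
    rw [← hfe]
    ring
  rw [e1]
  refine (abs_add_le _ _).trans (add_le_add ?_ (abs_stein_countSubsets_le h0 h1 _ hne hf))
  refine (abs_subsetExp_le h0 h1 _).trans ?_
  rw [← subsetExp_const p (K * |r - condMean k w|)]
  refine subsetExp_mono h0 h1 fun s => ?_
  rw [abs_mul, mul_comm K]
  exact mul_le_mul_of_nonneg_left (hf _) (abs_nonneg _)

lemma abs_condExpect_le {n k : ℕ} {w : Fin n → ℝ} (hw : ∀ i, 0 < w i) {h : ℕ → ℝ}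
    (hh : ∀ j, |h j| ≤ 1) : |condExpect k h w| ≤ 1 := by
  rw [← sum_graphProb w, condExpect]
  refine (Finset.abs_sum_le_sum_abs _ _).trans (Finset.sum_le_sum fun H _ => ?_)
  rw [abs_mul, abs_of_nonneg (graphProb_nonneg hw H)]
  exact mul_le_of_le_one_right (graphProb_nonneg hw H) (hh _)

lemma abs_integral_poissonMeasure_le (r : NNReal) {h : ℕ → ℝ} (hh : ∀ j, |h j| ≤ 1) :
    |∫ m, h m ∂poissonMeasure r| ≤ 1 := by
  have := norm_integral_le_of_norm_le_const (μ := poissonMeasure r) (f := h) (C := 1)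
    (Eventually.of_forall hh)
  simpa using this

/-- A function of the weights bounding the error of the conditional Poisson approximation, up to a
constant. The first two terms account for exceptional values of `∑ w x` and `∑ w x ^ 2`, the next
two for the deviation of the conditional mean, the last one for the overlapping cycles. -/
def errorBound {n : ℕ} (k : ℕ) (m₁ m₂ : ℝ) (w : Fin n → ℝ) : ℝ :=
  (n : ℝ)⁻¹ ^ 2 * (∑ x, (w x - m₁)) ^ 2 + (n : ℝ)⁻¹ ^ 2 * (∑ x, (w x ^ 2 - m₂)) ^ 2
    + (n : ℝ)⁻¹ ^ 2 * ∑ x, w x ^ 4 + (n : ℝ)⁻¹ * |∑ x, (m₁ * w x ^ 2 - m₂ * w x)|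
    + (n : ℝ)⁻¹ ^ (k + 1) * overlapMoment k w

lemma overlapMoment_nonneg {n : ℕ} (k : ℕ) (w : Fin n → ℝ) : 0 ≤ overlapMoment k w :=
  Finset.sum_nonneg fun _ _ => Finset.sum_nonneg fun _ _ =>
    mul_nonneg (by positivity) (Finset.prod_nonneg fun _ _ => by positivity)

lemma abs_sub_condMean_le {n k : ℕ} (hk : 3 ≤ k) (hn : 0 < n) {m₁ m₂ : ℝ} (h₁ : 0 < m₁)
    (h₂ : 0 < m₂) {w : Fin n → ℝ} (hw : ∀ i, 0 < w i) (hL : n * (m₁ / 2) ≤ ∑ x, w x)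
    (hS : ∑ x, w x ^ 2 ≤ n * (2 * m₂)) :
    |(m₂ / m₁) ^ k / (2 * k) - condMean k w|
      ≤ k * (2 * m₂ / (m₁ / 2)) ^ (k - 1) / (m₁ / 2 * m₁)
          * ((n : ℝ)⁻¹ * |∑ x, (m₁ * w x ^ 2 - m₂ * w x)|)
        + ((k : ℝ) ^ 2 * (2 * m₂) ^ (k - 2) / (m₁ / 2) ^ k
            + k * (2 * m₂) ^ (k - 1) / (m₁ / 2) ^ (k + 1)) * ((n : ℝ)⁻¹ ^ 2 * ∑ x, w x ^ 4) := by
  have hn' : (0 : ℝ) < n := by exact_mod_cast hn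
  have hk3 : (3 : ℝ) ≤ k := by exact_mod_cast hk
  have hL0 : 0 < ∑ x, w x := lt_of_lt_of_le (by positivity) hL
  have hmain := abs_condMean_sub_le hk hw hL0
  set L := ∑ x, w x with hLdef
  set S2 := ∑ x, w x ^ 2 with hS2
  set S4 := ∑ x, w x ^ 4 with hS4
  have hS2n : 0 ≤ S2 := Finset.sum_nonneg fun x _ => by positivity
  have hS4n : 0 ≤ S4 := Finset.sum_nonneg fun x _ => by positivity
  have hZ : ∑ x, (m₁ * w x ^ 2 - m₂ * w x) = m₁ * S2 - m₂ * L := by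
    rw [Finset.sum_sub_distrib, ← Finset.mul_sum, ← Finset.mul_sum]
  set Z := ∑ x, (m₁ * w x ^ 2 - m₂ * w x) with hZdef
  rw [abs_sub_comm]
  have htri : |condMean k w - (m₂ / m₁) ^ k / (2 * k)|
      ≤ |(S2 / L) ^ k / (2 * k) - (m₂ / m₁) ^ k / (2 * k)|
        + |condMean k w - (S2 / L) ^ k / (2 * k)| := by
    rw [add_comm]
    exact abs_sub_le _ _ _
  refine htri.trans (add_le_add ?_ (hmain.trans ?_))
  · have hQ0 : 0 ≤ S2 / L := by positivity
    have hQ : S2 / L ≤ 2 * m₂ / (m₁ / 2) := by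
      calc S2 / L ≤ (n * (2 * m₂)) / (n * (m₁ / 2)) := by gcongr
        _ = _ := by field_simp
    have hq : m₂ / m₁ ≤ 2 * m₂ / (m₁ / 2) := by
      gcongr <;> linarith
    have hdiff : |S2 / L - m₂ / m₁| ≤ (m₁ / 2 * m₁)⁻¹ * ((n : ℝ)⁻¹ * |Z|) := by
      have : S2 / L - m₂ / m₁ = Z / (L * m₁) := by
        rw [hZ, div_sub_div _ _ hL0.ne' h₁.ne']
        ring
      rw [this, abs_div, abs_of_pos (mul_pos hL0 h₁)]
      calc |Z| / (L * m₁) ≤ |Z| / (n * (m₁ / 2) * m₁) := by gcongr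
        _ = _ := by field_simp
    rw [← sub_div, abs_div, abs_of_pos (by linarith : (0 : ℝ) < 2 * k)]
    refine (div_le_self (abs_nonneg _) (by linarith)).trans ?_
    calc |(S2 / L) ^ k - (m₂ / m₁) ^ k|
        ≤ |S2 / L - m₂ / m₁| * k * max |S2 / L| |m₂ / m₁| ^ (k - 1) := abs_pow_sub_pow_le _ _ _
      _ ≤ ((m₁ / 2 * m₁)⁻¹ * ((n : ℝ)⁻¹ * |Z|)) * k * (2 * m₂ / (m₁ / 2)) ^ (k - 1) := by
        rw [abs_of_nonneg hQ0, abs_of_pos (div_pos h₂ h₁)]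
        have := max_le hQ hq
        gcongr
      _ = _ := by ring
  · rw [add_mul]
    refine add_le_add ?_ ?_
    · calc (k : ℝ) ^ 2 * (S4 * S2 ^ (k - 2)) / L ^ k
          ≤ (k : ℝ) ^ 2 * (S4 * (n * (2 * m₂)) ^ (k - 2)) / (n * (m₁ / 2)) ^ k := by gcongr
        _ = _ := by
          obtain ⟨j, rfl⟩ : ∃ j, k = j + 2 := ⟨k - 2, by omega⟩
          rw [Nat.add_sub_cancel, mul_pow, mul_pow _ _ (j + 2), pow_add (n : ℝ)]
          field_simp
    · calc (k : ℝ) * (S4 * S2 ^ (k - 1)) / L ^ (k + 1)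
          ≤ k * (S4 * (n * (2 * m₂)) ^ (k - 1)) / (n * (m₁ / 2)) ^ (k + 1) := by gcongr
        _ = _ := by
          obtain ⟨j, rfl⟩ : ∃ j, k = j + 1 := ⟨k - 1, by omega⟩
          rw [Nat.add_sub_cancel, mul_pow, mul_pow _ _ (j + 1 + 1), add_assoc j 1 1,
            pow_add (n : ℝ)]
          field_simp

/-- The error of the conditional Poisson approximation is bounded by a multiple of `errorBound`,
uniformly in the number of vertices, the weights and the test function. -/
lemma exists_abs_condExpect_sub_le {k : ℕ} (hk : 3 ≤ k) {m₁ m₂ : ℝ} (h₁ : 0 < m₁) (h₂ : 0 < m₂) :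
    ∃ C : ℝ, 0 ≤ C ∧ ∀ n : ℕ, 0 < n → ∀ w : Fin n → ℝ, (∀ i, 0 < w i) →
      ∀ h : ℕ → ℝ, (∀ j, |h j| ≤ 1) →
        |condExpect k h w
            - ∫ m, h m ∂poissonMeasure (Real.toNNReal ((m₂ / m₁) ^ k / (2 * (k : ℝ))))|
          ≤ C * errorBound k m₁ m₂ w := by
  set r := Real.toNNReal ((m₂ / m₁) ^ k / (2 * (k : ℝ))) with hr
  have hrr : (r : ℝ) = (m₂ / m₁) ^ k / (2 * (k : ℝ)) := Real.coe_toNNReal _ (by positivity)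
  set K := 2 * Real.exp (r : ℝ) with hK
  have hK0 : 0 ≤ K := by positivity
  set c₁ := k * (2 * m₂ / (m₁ / 2)) ^ (k - 1) / (m₁ / 2 * m₁) with hc₁
  set c₂ := (k : ℝ) ^ 2 * (2 * m₂) ^ (k - 2) / (m₁ / 2) ^ k
            + k * (2 * m₂) ^ (k - 1) / (m₁ / 2) ^ (k + 1) with hc₂
  set c := max 1 (2 / m₁) with hc
  have hc1 : 1 ≤ c := le_max_left _ _
  have hc₁0 : 0 ≤ c₁ := by positivity
  have hc₂0 : 0 ≤ c₂ := by positivity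
  set c₃ := 2 * c ^ (2 * k + 1) with hc₃
  have hc₃0 : 0 ≤ c₃ := by positivity
  set d₁ := 2 * (2 / m₁) ^ 2 with hd₁
  set d₂ := 2 * (1 / m₂) ^ 2 with hd₂
  have hd₁0 : 0 ≤ d₁ := by positivity
  have hd₂0 : 0 ≤ d₂ := by positivity
  refine ⟨d₁ + d₂ + K * c₁ + K * c₂ + 2 * K * c₃, by positivity, fun n hn w hw h hh => ?_⟩
  have hn' : (0 : ℝ) < n := by exact_mod_cast hn
  have hov := overlapMoment_nonneg k w
  set A₁ := (n : ℝ)⁻¹ ^ 2 * (∑ x, (w x - m₁)) ^ 2 with hA₁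
  set A₂ := (n : ℝ)⁻¹ ^ 2 * (∑ x, (w x ^ 2 - m₂)) ^ 2 with hA₂
  set A₃ := (n : ℝ)⁻¹ ^ 2 * ∑ x, w x ^ 4 with hA₃
  set A₄ := (n : ℝ)⁻¹ * |∑ x, (m₁ * w x ^ 2 - m₂ * w x)| with hA₄
  set A₅ := (n : ℝ)⁻¹ ^ (k + 1) * overlapMoment k w with hA₅
  have hA₁0 : 0 ≤ A₁ := by positivity
  have hA₂0 : 0 ≤ A₂ := by positivity
  have hA₃0 : 0 ≤ A₃ := mul_nonneg (by positivity) (Finset.sum_nonneg fun x _ => by positivity)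
  have hA₄0 : 0 ≤ A₄ := by positivity
  have hA₅0 : 0 ≤ A₅ := by positivity
  have herr : errorBound k m₁ m₂ w = A₁ + A₂ + A₃ + A₄ + A₅ := rfl
  have hexpand : ∀ {x : ℝ}, x ≤ d₁ * A₁ + d₂ * A₂ + K * c₁ * A₄ + K * c₂ * A₃ + 2 * K * c₃ * A₅ →
      x ≤ (d₁ + d₂ + K * c₁ + K * c₂ + 2 * K * c₃) * errorBound k m₁ m₂ w := by
    intro x hx
    refine hx.trans ?_
    rw [herr]
    have a1 : 0 ≤ K * c₁ := by positivity
    have a2 : 0 ≤ K * c₂ := by positivity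
    have a3 : 0 ≤ 2 * K * c₃ := by positivity
    have key : ∀ {d s A : ℝ}, 0 ≤ A → d ≤ s → d * A ≤ s * A := fun hA h =>
      mul_le_mul_of_nonneg_right h hA
    rw [mul_add, mul_add, mul_add, mul_add]
    have b1 := key hA₁0 (show d₁ ≤ d₁ + d₂ + K * c₁ + K * c₂ + 2 * K * c₃ by linarith)
    have b2 := key hA₂0 (show d₂ ≤ d₁ + d₂ + K * c₁ + K * c₂ + 2 * K * c₃ by linarith)
    have b3 := key hA₃0 (show K * c₂ ≤ d₁ + d₂ + K * c₁ + K * c₂ + 2 * K * c₃ by linarith)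
    have b4 := key hA₄0 (show K * c₁ ≤ d₁ + d₂ + K * c₁ + K * c₂ + 2 * K * c₃ by linarith)
    have b5 := key hA₅0 (show 2 * K * c₃ ≤ d₁ + d₂ + K * c₁ + K * c₂ + 2 * K * c₃ by linarith)
    linarith
  refine hexpand ?_
  have hp1 : 0 ≤ d₁ * A₁ := by positivity
  have hp2 : 0 ≤ d₂ * A₂ := by positivity
  have hp3 : 0 ≤ K * c₂ * A₃ := by positivity
  have hp4 : 0 ≤ K * c₁ * A₄ := by positivity
  have hp5 : 0 ≤ 2 * K * c₃ * A₅ := by positivity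
  have htriv : |condExpect k h w - ∫ m, h m ∂poissonMeasure r| ≤ 2 := by
    have := abs_sub (condExpect k h w) (∫ m, h m ∂poissonMeasure r)
    have := abs_condExpect_le (k := k) hw hh
    have := abs_integral_poissonMeasure_le r hh
    linarith
  have hsum₁ : ∑ x, (w x - m₁) = ∑ x, w x - n * m₁ := by
    simp [Finset.sum_sub_distrib]
  have hsum₂ : ∑ x, (w x ^ 2 - m₂) = ∑ x, w x ^ 2 - n * m₂ := by
    simp [Finset.sum_sub_distrib]
  by_cases hL : n * (m₁ / 2) ≤ ∑ x, w x
  swap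
  · -- the total weight is exceptionally small
    have h3 : 2 ≤ d₁ * A₁ := by
      have h4 : 1 ≤ (2 / m₁ * ((n : ℝ)⁻¹ * -∑ x, (w x - m₁))) := by
        rw [hsum₁, ← div_eq_inv_mul, div_mul_div_comm, one_le_div (by positivity)]
        push Not at hL
        linarith
      have h5 := one_le_pow₀ (n := 2) h4
      calc (2 : ℝ) ≤ 2 * (2 / m₁ * ((n : ℝ)⁻¹ * -∑ x, (w x - m₁))) ^ 2 := by linarith
        _ = d₁ * A₁ := by rw [hd₁, hA₁]; ring
    linarith
  by_cases hS : ∑ x, w x ^ 2 ≤ n * (2 * m₂)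
  swap
  · -- the sum of the squared weights is exceptionally large
    have h3 : 2 ≤ d₂ * A₂ := by
      have h4 : 1 ≤ (1 / m₂ * ((n : ℝ)⁻¹ * ∑ x, (w x ^ 2 - m₂))) := by
        rw [hsum₂, ← div_eq_inv_mul, div_mul_div_comm, one_le_div (by positivity)]
        push Not at hS
        linarith
      have h5 := one_le_pow₀ (n := 2) h4
      calc (2 : ℝ) ≤ 2 * (1 / m₂ * ((n : ℝ)⁻¹ * ∑ x, (w x ^ 2 - m₂))) ^ 2 := by linarith
        _ = d₂ * A₂ := by rw [hd₂, hA₂]; ring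
    linarith
  have hmean := abs_sub_condMean_le hk hn h₁ h₂ hw hL hS
  have hL0 : 0 < ∑ x, w x := lt_of_lt_of_le (by positivity) hL
  have hp : ∀ i j, edgeProb w i j ≤ c * (n : ℝ)⁻¹ * (w i * w j) := by
    intro i j
    have hij := mul_pos (hw i) (hw j)
    rw [edgeProb]
    split_ifs
    · positivity
    · calc w i * w j / (∑ l, w l + w i * w j) ≤ w i * w j / (n * (m₁ / 2)) := by
            gcongr
            linarith
        _ = 2 / m₁ * (n : ℝ)⁻¹ * (w i * w j) := by field_simp
        _ ≤ c * (n : ℝ)⁻¹ * (w i * w j) := by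
            gcongr
            exact le_max_right _ _
  have hover := overlapSum_le hk hw hc1 hp
  have hst := abs_condExpect_sub_le_stein hk hw r hh
  rw [hrr] at hst
  have g1 := mul_le_mul_of_nonneg_left hmean hK0
  have g2 := mul_le_mul_of_nonneg_left hover (by positivity : 0 ≤ 2 * K)
  rw [← hrr] at hst g1
  calc _ ≤ _ := hst
    _ ≤ K * (c₁ * A₄ + c₂ * A₃) + 2 * K * (c₃ * A₅) := add_le_add g1 g2
    _ ≤ _ := by linarith

/-! ### Moments of the weights -/

/-- The tail condition yields the fourth moment, by the layer cake formula. -/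
lemma integrable_pow_four_of_tail {Ω₀ : Type*} [MeasurableSpace Ω₀] (μ : Measure Ω₀)
    [IsProbabilityMeasure μ] {W : Ω₀ → ℝ} (hW : Measurable W) (hpos : ∀ᵐ ω ∂μ, 0 < W ω)
    {k : ℕ} (hk : 3 ≤ k)
    (htail : (fun x : ℝ => μ.real {ω | x < W ω}) =o[atTop] fun x : ℝ => x ^ (-2 * (k : ℤ) - 1)) :
    Integrable (fun ω => W ω ^ 4) μ := by
  obtain ⟨T, hT⟩ := eventually_atTop.1 (htail.def zero_lt_one)
  set T' := max T 1 with hT'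
  have hT'0 : 0 < T' := lt_of_lt_of_le one_pos (le_max_right _ _)
  have htail' : ∀ t, T' < t → μ {ω | t < W ω} ≤ ENNReal.ofReal (t ^ (-7 : ℝ)) := by
    intro t ht
    have ht1 : 1 ≤ t := (le_max_right T 1).trans ht.le
    have h := hT t ((le_max_left T 1).trans ht.le)
    rw [Real.norm_of_nonneg measureReal_nonneg, one_mul, Real.norm_of_nonneg (by positivity)] at h
    rw [← ofReal_measureReal]
    refine ENNReal.ofReal_le_ofReal (h.trans ?_)
    rw [← Real.rpow_intCast]
    refine Real.rpow_le_rpow_of_exponent_le ht1 ?_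
    push_cast
    have : (3 : ℝ) ≤ k := by exact_mod_cast hk
    linarith
  have hfin : ∫⁻ ω, ENNReal.ofReal (W ω ^ 4) ∂μ < ⊤ := by
    have h4 : ∀ ω, W ω ^ 4 = W ω ^ (4 : ℝ) := fun ω => by
      rw [← Real.rpow_natCast]
      norm_num
    simp only [h4]
    rw [lintegral_rpow_eq_lintegral_meas_lt_mul μ (hpos.mono fun ω h => h.le) hW.aemeasurable
      (by norm_num)]
    refine ENNReal.mul_lt_top ENNReal.ofReal_lt_top ?_
    rw [← Set.Ioc_union_Ioi_eq_Ioi hT'0.le]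
    refine (lintegral_union_le _ _ _).trans_lt (ENNReal.add_lt_top.2 ⟨?_, ?_⟩)
    · calc ∫⁻ t in Set.Ioc 0 T', μ {ω | t < W ω} * ENNReal.ofReal (t ^ ((4 : ℝ) - 1))
          ≤ ∫⁻ _t in Set.Ioc 0 T', ENNReal.ofReal (T' ^ ((4 : ℝ) - 1)) := by
            refine setLIntegral_mono measurable_const fun t ht => ?_
            calc μ {ω | t < W ω} * ENNReal.ofReal (t ^ ((4 : ℝ) - 1))
                ≤ 1 * ENNReal.ofReal (T' ^ ((4 : ℝ) - 1)) := by
                  refine mul_le_mul' prob_le_one (ENNReal.ofReal_le_ofReal ?_)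
                  exact Real.rpow_le_rpow ht.1.le ht.2 (by norm_num)
              _ = _ := one_mul _
        _ < ⊤ := by
            rw [setLIntegral_const, Real.volume_Ioc]
            exact ENNReal.mul_lt_top ENNReal.ofReal_lt_top ENNReal.ofReal_lt_top
    · calc ∫⁻ t in Set.Ioi T', μ {ω | t < W ω} * ENNReal.ofReal (t ^ ((4 : ℝ) - 1))
          ≤ ∫⁻ t in Set.Ioi T', ENNReal.ofReal (t ^ (-4 : ℝ)) := by
            refine setLIntegral_mono (by fun_prop) fun t ht => ?_
            have ht0 : 0 < t := hT'0.trans ht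
            refine (mul_le_mul_left (htail' t ht) _).trans ?_
            rw [← ENNReal.ofReal_mul (by positivity), ← Real.rpow_add ht0]
            norm_num
        _ < ⊤ := (integrableOn_Ioi_rpow_of_lt (by norm_num) hT'0).lintegral_lt_top
  refine ⟨(hW.pow_const 4).aestronglyMeasurable, ?_⟩
  rw [hasFiniteIntegral_iff_ofReal (Eventually.of_forall fun ω => by positivity)]
  exact hfin

section Moments

variable {ν : Measure ℝ} [IsProbabilityMeasure ν]

lemma integrable_of_pow_four (h4 : Integrable (fun x : ℝ => x ^ 4) ν) :
    Integrable (fun x : ℝ => x) ν := by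
  refine ((integrable_const (1 : ℝ)).add h4).mono' (by fun_prop) (Eventually.of_forall fun x => ?_)
  simp only [Pi.add_apply, Real.norm_eq_abs]
  rw [abs_le]
  constructor <;> nlinarith [sq_nonneg (x ^ 2 - 1), sq_nonneg (x - 1), sq_nonneg (x + 1)]

lemma integrable_sq_of_pow_four (h4 : Integrable (fun x : ℝ => x ^ 4) ν) :
    Integrable (fun x : ℝ => x ^ 2) ν := by
  refine ((integrable_const (1 : ℝ)).add h4).mono' (by fun_prop) (Eventually.of_forall fun x => ?_)
  simp only [Pi.add_apply, Real.norm_eq_abs]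
  rw [abs_le]
  constructor <;> nlinarith [sq_nonneg (x ^ 2 - 1), sq_nonneg (x ^ 2)]

lemma integrable_max_pow_four (h4 : Integrable (fun x : ℝ => x ^ 4) ν) :
    Integrable (fun x : ℝ => max 1 x ^ 4) ν := by
  refine ((integrable_const (1 : ℝ)).add h4).mono' (by fun_prop) (Eventually.of_forall fun x => ?_)
  simp only [Pi.add_apply, Real.norm_eq_abs]
  rw [abs_of_nonneg (by positivity)]
  rcases max_cases 1 x with ⟨h, -⟩ | ⟨h, -⟩ <;> rw [h] <;> nlinarith [sq_nonneg (x ^ 2)]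

lemma memLp_two_of_pow_four (h4 : Integrable (fun x : ℝ => x ^ 4) ν) :
    MemLp (fun x : ℝ => x) 2 ν ∧ MemLp (fun x : ℝ => x ^ 2) 2 ν := by
  constructor
  · exact (memLp_two_iff_integrable_sq (by fun_prop)).2 (integrable_sq_of_pow_four h4)
  · refine (memLp_two_iff_integrable_sq (by fun_prop)).2 ?_
    simpa only [← pow_mul] using h4

/-! ### Expectations for independent weights -/

lemma integrable_comp_eval {n : ℕ} {g : ℝ → ℝ} (hg : Integrable g ν) (i : Fin n) :
    Integrable (fun x : Fin n → ℝ => g (x i)) (Measure.pi fun _ => ν) :=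
  ((measurePreserving_eval (fun _ : Fin n => ν) i).integrable_comp hg.aestronglyMeasurable).2 hg

lemma integral_sum_comp_eval {n : ℕ} {g : ℝ → ℝ} (hg : Integrable g ν) :
    ∫ x : Fin n → ℝ, ∑ i, g (x i) ∂(Measure.pi fun _ => ν) = n * ∫ y, g y ∂ν := by
  rw [integral_finsetSum _ fun i _ => integrable_comp_eval hg i]
  simp [integral_comp_eval (μ := fun _ : Fin n => ν) hg.aestronglyMeasurable]

/-- The second moment of a sum of independent centred variables. -/
lemma integral_sq_sum_comp_eval {n : ℕ} {g : ℝ → ℝ} (hg : MemLp g 2 ν) (h0 : ∫ y, g y ∂ν = 0) :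
    Integrable (fun x : Fin n → ℝ => (∑ i, g (x i)) ^ 2) (Measure.pi fun _ => ν) ∧
      ∫ x : Fin n → ℝ, (∑ i, g (x i)) ^ 2 ∂(Measure.pi fun _ => ν) = n * ∫ y, g y ^ 2 ∂ν := by
  have hgi : Integrable g ν := hg.integrable (by norm_num)
  have hL : MemLp (fun x : Fin n → ℝ => ∑ i, g (x i)) 2 (Measure.pi fun _ => ν) :=
    memLp_finsetSum _ fun i _ => hg.comp_measurePreserving (measurePreserving_eval _ i)
  refine ⟨hL.integrable_sq, ?_⟩
  have h1 := variance_sum_pi (μ := fun _ : Fin n => ν) (X := fun _ => g) fun _ => hg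
  have h2 : (∑ i : Fin n, fun x : Fin n → ℝ => g (x i)) = fun x => ∑ i, g (x i) := by
    ext x
    simp
  rw [h2, variance_of_integral_eq_zero hL.aestronglyMeasurable.aemeasurable,
    variance_of_integral_eq_zero hg.aestronglyMeasurable.aemeasurable h0] at h1
  · simpa using h1
  · rw [integral_sum_comp_eval hgi, h0, mul_zero]

lemma integral_overlapMoment {n k : ℕ} (hn : 0 < n) (h4 : Integrable (fun x : ℝ => x ^ 4) ν) :
    Integrable (fun x : Fin n → ℝ => overlapMoment k x) (Measure.pi fun _ => ν) ∧
      ∫ x : Fin n → ℝ, overlapMoment k x ∂(Measure.pi fun _ => ν)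
        ≤ (n : ℝ) ^ k * (((k : ℝ) + 1) ^ k * (∫ y, max 1 y ^ 4 ∂ν) ^ (2 * k)) := by
  classical
  have hmax := integrable_max_pow_four h4
  set M := ∫ y, max 1 y ^ 4 ∂ν with hM
  have hM1 : 1 ≤ M := by
    have : ∫ _y : ℝ, (1 : ℝ) ∂ν ≤ M := integral_mono (integrable_const _) hmax fun y =>
      one_le_pow₀ (le_max_left 1 y)
    simpa using this
  have hprod : ∀ (V : Finset (Fin n)) (x : Fin n → ℝ),
      ∏ i ∈ V, max 1 (x i) ^ 4 = ∏ i, (if i ∈ V then fun y : ℝ => max 1 y ^ 4 else 1) (x i) := by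
    intro V x
    rw [← Finset.prod_filter_mul_prod_filter_not Finset.univ (· ∈ V)]
    rw [Finset.prod_eq_one (s := Finset.univ.filter fun i => i ∉ V), mul_one]
    · refine Finset.prod_congr (by simp) fun i hi => ?_
      rw [if_pos (by simpa using hi)]
    · intro i hi
      rw [if_neg (Finset.mem_filter.1 hi).2]
      rfl
  have hint : ∀ V : Finset (Fin n),
      Integrable (fun x : Fin n → ℝ => ∏ i ∈ V, max 1 (x i) ^ 4) (Measure.pi fun _ => ν) := by
    intro V
    simp only [hprod]
    refine Integrable.fintype_prod fun i => ?_
    split_ifs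
    · exact hmax
    · exact integrable_const 1
  have hval : ∀ V : Finset (Fin n),
      ∫ x : Fin n → ℝ, ∏ i ∈ V, max 1 (x i) ^ 4 ∂(Measure.pi fun _ => ν) = M ^ V.card := by
    intro V
    simp only [hprod]
    rw [integral_fintype_prod_eq_prod, ← Finset.prod_const,
      ← Finset.prod_subset (Finset.subset_univ V)]
    · exact Finset.prod_congr rfl fun i hi => by rw [if_pos hi]
    · intro i _ hi
      rw [if_neg hi]
      simp
  have hint' : ∀ v v' : Fin k → Fin n, Integrable (fun x : Fin n → ℝ =>
      ((n : ℝ)⁻¹) ^ (newIndices v v').card *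
        ∏ i ∈ Finset.univ.image v ∪ Finset.univ.image v', max 1 (x i) ^ 4)
      (Measure.pi fun _ => ν) := fun v v' => (hint _).const_mul _
  refine ⟨integrable_finsetSum _ fun v _ => integrable_finsetSum _ fun v' _ => hint' v v', ?_⟩
  simp only [overlapMoment]
  rw [integral_finsetSum _ fun v _ => integrable_finsetSum _ fun v' _ => hint' v v']
  have hcard : ∀ v v' : Fin k → Fin n,
      (Finset.univ.image v ∪ Finset.univ.image v').card ≤ 2 * k := fun v v' => by
    refine (Finset.card_union_le _ _).trans ?_
    rw [two_mul]
    exact add_le_add (Finset.card_image_le.trans (by simp)) (Finset.card_image_le.trans (by simp))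
  calc ∑ v : Fin k → Fin n, ∫ x : Fin n → ℝ, ∑ v' : Fin k → Fin n,
        ((n : ℝ)⁻¹) ^ (newIndices v v').card *
          ∏ i ∈ Finset.univ.image v ∪ Finset.univ.image v', max 1 (x i) ^ 4
            ∂(Measure.pi fun _ => ν)
      ≤ ∑ _v : Fin k → Fin n, ((k : ℝ) + 1) ^ k * M ^ (2 * k) := by
        refine Finset.sum_le_sum fun v _ => ?_
        rw [integral_finsetSum _ fun v' _ => hint' v v']
        refine le_trans ?_ (mul_le_mul_of_nonneg_right (sum_newIndices_le v) (by positivity))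
        rw [Finset.sum_mul]
        refine Finset.sum_le_sum fun v' _ => ?_
        rw [integral_const_mul, hval]
        exact mul_le_mul_of_nonneg_left (pow_le_pow_right₀ hM1 (hcard v v')) (by positivity)
    _ = _ := by simp

/-- The expected error of the conditional Poisson approximation is of order `n ^ (-1/2)`; the term
responsible for this order is the deviation of the conditional mean. -/
lemma exists_integral_errorBound_le (k : ℕ) (h4 : Integrable (fun x : ℝ => x ^ 4) ν) :
    ∃ C : ℝ, ∀ n : ℕ, 0 < n →
      Integrable (fun x : Fin n → ℝ => errorBound k (∫ y, y ∂ν) (∫ y, y ^ 2 ∂ν) x)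
        (Measure.pi fun _ => ν) ∧
      ∫ x : Fin n → ℝ, errorBound k (∫ y, y ∂ν) (∫ y, y ^ 2 ∂ν) x ∂(Measure.pi fun _ => ν)
        ≤ C * (n : ℝ) ^ (-(1 / 2) : ℝ) := by
  obtain ⟨hL1, hL2⟩ := memLp_two_of_pow_four h4
  have hi1 := integrable_of_pow_four h4
  have hi2 := integrable_sq_of_pow_four h4
  set m₁ := ∫ y, y ∂ν with hm₁
  set m₂ := ∫ y, y ^ 2 ∂ν with hm₂
  have e1 : ∫ y, (y - m₁) ∂ν = 0 := by
    rw [integral_sub hi1 (integrable_const _)]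
    simp [hm₁]
  have e2 : ∫ y, (y ^ 2 - m₂) ∂ν = 0 := by
    rw [integral_sub hi2 (integrable_const _)]
    simp [hm₂]
  have e3 : ∫ y, (m₁ * y ^ 2 - m₂ * y) ∂ν = 0 := by
    rw [integral_sub (hi2.const_mul _) (hi1.const_mul _), integral_const_mul, integral_const_mul,
      ← hm₁, ← hm₂]
    ring
  have l1 : MemLp (fun y => y - m₁) 2 ν := hL1.sub (memLp_const _)
  have l2 : MemLp (fun y => y ^ 2 - m₂) 2 ν := hL2.sub (memLp_const _)
  have l3 : MemLp (fun y => m₁ * y ^ 2 - m₂ * y) 2 ν := (hL2.const_mul _).sub (hL1.const_mul _)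
  set V₁ := ∫ y, (y - m₁) ^ 2 ∂ν with hV₁
  set V₂ := ∫ y, (y ^ 2 - m₂) ^ 2 ∂ν with hV₂
  set V₃ := ∫ y, (m₁ * y ^ 2 - m₂ * y) ^ 2 ∂ν with hV₃
  set V₄ := ∫ y, y ^ 4 ∂ν with hV₄
  set M := ((k : ℝ) + 1) ^ k * (∫ y, max 1 y ^ 4 ∂ν) ^ (2 * k) with hM
  have hV₁0 : 0 ≤ V₁ := integral_nonneg fun y => sq_nonneg _
  have hV₂0 : 0 ≤ V₂ := integral_nonneg fun y => sq_nonneg _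
  have hV₄0 : 0 ≤ V₄ := integral_nonneg fun y => by positivity
  have hM0 : 0 ≤ M := mul_nonneg (by positivity)
    (pow_nonneg (integral_nonneg fun y => by positivity) _)
  refine ⟨V₁ + V₂ + V₄ + (1 + V₃) / 2 + M, fun n hn => ?_⟩
  have hn' : (0 : ℝ) < n := by exact_mod_cast hn
  set s := (n : ℝ) ^ (-(1 / 2) : ℝ) with hs
  have hs0 : 0 < s := Real.rpow_pos_of_pos hn' _
  have hs1 : s ≤ 1 := Real.rpow_le_one_of_one_le_of_nonpos (by exact_mod_cast hn) (by norm_num)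
  have hss : (n : ℝ)⁻¹ = s ^ 2 := by
    rw [hs, ← Real.rpow_natCast, ← Real.rpow_mul hn'.le, ← Real.rpow_neg_one]
    norm_num
  have hns : (n : ℝ) * s ^ 2 = 1 := by rw [← hss, mul_inv_cancel₀ hn'.ne']
  obtain ⟨a1, b1⟩ := integral_sq_sum_comp_eval (n := n) l1 e1
  obtain ⟨a2, b2⟩ := integral_sq_sum_comp_eval (n := n) l2 e2
  obtain ⟨a3, b3⟩ := integral_sq_sum_comp_eval (n := n) l3 e3
  have a4 : Integrable (fun x : Fin n → ℝ => ∑ i, x i ^ 4) (Measure.pi fun _ => ν) :=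
    integrable_finsetSum _ fun i _ => integrable_comp_eval h4 i
  have b4 := integral_sum_comp_eval (n := n) h4
  obtain ⟨a5, b5⟩ := integral_overlapMoment (k := k) hn h4
  -- the deviation of the conditional mean, `|z| ≤ (1 + z ^ 2) / 2` at the scale `√n`
  have hdev : ∀ z : ℝ, (n : ℝ)⁻¹ * |z| ≤ s / 2 * (1 + s ^ 2 * z ^ 2) := by
    intro z
    rw [hss]
    have h1 : 2 * (s * |z|) ≤ 1 + s ^ 2 * z ^ 2 := by
      have := sq_nonneg (s * |z| - 1)
      have h2 := sq_abs z
      nlinarith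
    nlinarith
  set U : (Fin n → ℝ) → ℝ := fun x =>
    (n : ℝ)⁻¹ ^ 2 * (∑ i, (x i - m₁)) ^ 2 + (n : ℝ)⁻¹ ^ 2 * (∑ i, (x i ^ 2 - m₂)) ^ 2
    + (n : ℝ)⁻¹ ^ 2 * ∑ i, x i ^ 4
    + s / 2 * (1 + s ^ 2 * (∑ i, (m₁ * x i ^ 2 - m₂ * x i)) ^ 2)
    + (n : ℝ)⁻¹ ^ (k + 1) * overlapMoment k x with hU
  have c1 := a1.const_mul ((n : ℝ)⁻¹ ^ 2)
  have c2 := a2.const_mul ((n : ℝ)⁻¹ ^ 2)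
  have c4 := a4.const_mul ((n : ℝ)⁻¹ ^ 2)
  have c3 := ((integrable_const (1 : ℝ)).fun_add (a3.const_mul (s ^ 2))).const_mul (s / 2)
  have c5 := a5.const_mul ((n : ℝ)⁻¹ ^ (k + 1))
  have hUint : Integrable U (Measure.pi fun _ => ν) :=
    (((c1.fun_add c2).fun_add c4).fun_add c3).fun_add c5
  have hle : ∀ x : Fin n → ℝ, errorBound k m₁ m₂ x ≤ U x := fun x => by
    have := hdev (∑ i, (m₁ * x i ^ 2 - m₂ * x i))
    simp only [errorBound, hU]
    linarith
  have hnn : ∀ x : Fin n → ℝ, 0 ≤ errorBound k m₁ m₂ x := fun x => by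
    have h1 := overlapMoment_nonneg k x
    have h2 : 0 ≤ ∑ i, x i ^ 4 := Finset.sum_nonneg fun i _ => by positivity
    unfold errorBound
    positivity
  have hmeas : AEStronglyMeasurable (fun x : Fin n → ℝ => errorBound k m₁ m₂ x)
      (Measure.pi fun _ => ν) := by
    refine Measurable.aestronglyMeasurable ?_
    unfold errorBound overlapMoment
    fun_prop
  have hint : Integrable (fun x : Fin n → ℝ => errorBound k m₁ m₂ x) (Measure.pi fun _ => ν) :=
    hUint.mono' hmeas (Eventually.of_forall fun x => by
      rw [Real.norm_of_nonneg (hnn x)]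
      exact hle x)
  refine ⟨hint, (integral_mono hint hUint hle).trans ?_⟩
  have hUval : ∫ x, U x ∂(Measure.pi fun _ => ν)
      = (n : ℝ)⁻¹ ^ 2 * (n * V₁) + (n : ℝ)⁻¹ ^ 2 * (n * V₂) + (n : ℝ)⁻¹ ^ 2 * (n * V₄)
        + s / 2 * (1 + s ^ 2 * (n * V₃))
        + (n : ℝ)⁻¹ ^ (k + 1) * ∫ x : Fin n → ℝ, overlapMoment k x ∂(Measure.pi fun _ => ν) := by
    simp only [hU]
    rw [integral_add (((c1.fun_add c2).fun_add c4).fun_add c3) c5,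
      integral_add ((c1.fun_add c2).fun_add c4) c3, integral_add (c1.fun_add c2) c4,
      integral_add c1 c2, integral_const_mul, integral_const_mul,
      integral_const_mul, integral_const_mul, integral_const_mul, b1, b2, b4,
      integral_add (integrable_const _) (a3.const_mul _), integral_const_mul, b3]
    simp [hV₁, hV₂, hV₃, hV₄]
  rw [hUval]
  have hle5 : (n : ℝ)⁻¹ ^ (k + 1) * ∫ x : Fin n → ℝ, overlapMoment k x ∂(Measure.pi fun _ => ν)
      ≤ s ^ 2 * M := by
    calc _ ≤ (n : ℝ)⁻¹ ^ (k + 1) * ((n : ℝ) ^ k * M) :=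
          mul_le_mul_of_nonneg_left b5 (by positivity)
      _ = s ^ 2 * M := by
          rw [← hss, pow_succ, inv_pow]
          field_simp
  have hscale : ∀ V : ℝ, (n : ℝ)⁻¹ ^ 2 * (n * V) = s ^ 2 * V := fun V => by
    rw [← hss]
    field_simp
  have hsq : ∀ V : ℝ, 0 ≤ V → s ^ 2 * V ≤ s * V := fun V hV =>
    mul_le_mul_of_nonneg_right (by nlinarith) hV
  have hV₃ : s ^ 2 * (n * V₃) = V₃ := by rw [← mul_assoc, mul_comm (s ^ 2), hns, one_mul]
  rw [hscale, hscale, hscale, hV₃]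
  have := hsq V₁ hV₁0
  have := hsq V₂ hV₂0
  have := hsq V₄ hV₄0
  have := hsq M hM0
  linarith

end Moments

/-! ### The unconditional law of the number of cycles -/

lemma measurable_graphProb {n : ℕ} (H : SimpleGraph (Fin n)) :
    Measurable fun w : Fin n → ℝ => graphProb w H := by
  classical
  have he : ∀ i j : Fin n, Measurable fun w : Fin n → ℝ => edgeProb w i j := fun i j => by
    unfold edgeProb
    split_ifs <;> fun_prop
  unfold graphProb
  refine Finset.measurable_fun_prod _ fun i _ => Finset.measurable_fun_prod _ fun j _ => ?_
  split_ifs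
  · exact he i j
  · exact (he i j).const_sub 1

lemma measurable_condExpect {n k : ℕ} (h : ℕ → ℝ) :
    Measurable fun w : Fin n → ℝ => condExpect k h w := by
  unfold condExpect
  exact Finset.measurable_fun_sum _ fun H _ => (measurable_graphProb H).mul_const _

lemma measurable_of_simpleGraph {n : ℕ} {β : Type*} [MeasurableSpace β]
    (f : SimpleGraph (Fin n) → β) : Measurable f := by
  have hsing : ∀ H : SimpleGraph (Fin n), MeasurableSet {H} := fun H => by
    have : ({H} : Set (SimpleGraph (Fin n))) = ⋂ u, ⋂ v, {G | G.Adj u v ↔ H.Adj u v} := by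
      ext G
      simp only [Set.mem_singleton_iff, Set.mem_iInter, Set.mem_ofPred_eq]
      exact ⟨fun h u v => by rw [h], fun h => by ext u v; exact h u v⟩
    rw [this]
    refine MeasurableSet.iInter fun u => MeasurableSet.iInter fun v => ?_
    have hm : Measurable fun G : SimpleGraph (Fin n) => G.Adj u v :=
      SimpleGraph.measurable_iff_adj.1 measurable_id u v
    by_cases hH : H.Adj u v
    · simpa [hH] using measurableSet_setOfPred.2 hm
    · simpa [hH] using measurableSet_setOfPred.2 hm.not
  intro s _
  rw [← Set.biUnion_of_singleton (f ⁻¹' s)]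
  exact (Set.toFinite (f ⁻¹' s)).measurableSet_biUnion fun H _ => hsing H

/-- The law of the number of cycles is the mixture of its conditional laws. -/
lemma integral_map_numCycles {Ω : Type*} [MeasurableSpace Ω] {P : Measure Ω}
    [IsProbabilityMeasure P] {n : ℕ} {X : Fin n → Ω → ℝ} {G : Ω → SimpleGraph (Fin n)}
    (hG : IsGeneralizedRandomGraph P X G) (k : ℕ) {h : ℕ → ℝ} :
    ∫ m, h m ∂(P.map fun ω => numCycles k (G ω)) = ∫ ω, condExpect k h (fun i => X i ω) ∂P := by
  classical
  have hm : Measurable fun ω => fun i => X i ω := measurable_pi_iff.2 hG.measurable_weight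
  have hN : Measurable fun ω => numCycles k (G ω) :=
    (measurable_of_simpleGraph (numCycles k)).comp hG.measurable_graph
  have hset : ∀ H, MeasurableSet {ω | G ω = H} := fun H =>
    measurableSet_setOfPred.2
      ((measurable_of_simpleGraph fun G' => G' = H).comp hG.measurable_graph)
  have hprob : ∀ H, ∫ ω, ({ω | G ω = H}.indicator (fun _ => (1 : ℝ))) ω ∂P
      = ∫ ω, graphProb (fun i => X i ω) H ∂P := fun H => by
    rw [← integral_congr_ae (hG.condProb_eq H)]
    exact (integral_condExp hm.comap_le).symm
  have hint : ∀ H, Integrable (fun ω => graphProb (fun i => X i ω) H) P := fun H =>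
    integrable_condExp.congr (hG.condProb_eq H)
  have hind : ∀ H, Integrable ({ω | G ω = H}.indicator (fun _ => (1 : ℝ))) P := fun H =>
    (integrable_const _).indicator (hset H)
  rw [integral_map hN.aemeasurable (by fun_prop)]
  have hsplit : ∀ ω, h (numCycles k (G ω))
      = ∑ H, ({ω | G ω = H}.indicator (fun _ => (1 : ℝ))) ω * h (numCycles k H) := fun ω => by
    rw [Finset.sum_eq_single (G ω) (fun H _ hH => ?_) (by simp)]
    · simp
    · rw [Set.indicator_of_notMem (by simpa using hH.symm), zero_mul]
  simp only [hsplit, condExpect]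
  rw [integral_finsetSum _ fun H _ => (hind H).mul_const _,
    integral_finsetSum _ fun H _ => (hint H).mul_const _]
  refine Finset.sum_congr rfl fun H _ => ?_
  rw [integral_mul_const, integral_mul_const, hprob]

end GRG
end

theorem theorem1
    -- the generic weight `W`, an almost surely positive random variable
    {Ω₀ : Type*} [MeasurableSpace Ω₀] (μ : Measure Ω₀) [IsProbabilityMeasure μ]
    (W : Ω₀ → ℝ) (hW : Measurable W) (hpos : ∀ᵐ ω ∂μ, 0 < W ω)
    -- the cycle length and the tail condition
    (k : ℕ) (hk : 3 ≤ k)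
    (htail : (fun x : ℝ => μ.real {ω | x < W ω}) =o[atTop] fun x : ℝ => x ^ (-2 * (k : ℤ) - 1))
    -- for every `n`, i.i.d. weights distributed as `W` and the graph on `n` vertices
    {Ω : ℕ → Type*} [∀ n, MeasurableSpace (Ω n)] (P : ∀ n, Measure (Ω n))
    [∀ n, IsProbabilityMeasure (P n)]
    (X : ∀ n, Fin n → Ω n → ℝ)
    (hindep : ∀ n, iIndepFun (X n) (P n))
    (hident : ∀ n i, IdentDistrib (X n i) W (P n) μ)
    (G : ∀ n, Ω n → SimpleGraph (Fin n))
    (hG : ∀ n, GRG.IsGeneralizedRandomGraph (P n) (X n) (G n)) :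
    (fun n : ℕ => GRG.tvDist ((P n).map fun ω => GRG.numCycles k (G n ω))
        (poissonMeasure
          (Real.toNNReal (((∫ ω, W ω ^ 2 ∂μ) / ∫ ω, W ω ∂μ) ^ k / (2 * (k : ℝ))))))
      =O[atTop] fun n : ℕ => (n : ℝ) ^ (-(1 / 2) : ℝ) := by
  -- everything is expressed through the law `ν` of the generic weight
  set ν := μ.map W with hν
  have : IsProbabilityMeasure ν := Measure.isProbabilityMeasure_map hW.aemeasurable
  have h4 : Integrable (fun x : ℝ => x ^ 4) ν :=
    (integrable_map_measure (by fun_prop) hW.aemeasurable).2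
      (GRG.integrable_pow_four_of_tail μ hW hpos hk htail)
  have hνpos : ∀ᵐ x ∂ν, 0 < x :=
    (ae_map_iff hW.aemeasurable measurableSet_Ioi).2 hpos
  have hm₁ : ∫ ω, W ω ∂μ = ∫ y, y ∂ν :=
    (integral_map hW.aemeasurable (f := fun y : ℝ => y) (by fun_prop)).symm
  have hm₂ : ∫ ω, W ω ^ 2 ∂μ = ∫ y, y ^ 2 ∂ν :=
    (integral_map hW.aemeasurable (f := fun y : ℝ => y ^ 2) (by fun_prop)).symm
  rw [hm₁, hm₂]
  have hsupp : ∀ g : ℝ → ℝ, (∀ x, 0 < x → 0 < g x) → 0 < ν (Function.support g) := by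
    intro g hg
    have : Function.support g =ᵐ[ν] Set.univ := by
      refine eventuallyEq_univ.2 (hνpos.mono fun x hx => (hg x hx).ne')
    rw [measure_congr this, measure_univ]
    exact one_pos
  have h₁ : 0 < ∫ y, y ∂ν :=
    (integral_pos_iff_support_of_nonneg_ae (hνpos.mono fun x hx => hx.le)
      (GRG.integrable_of_pow_four h4)).2 (hsupp _ fun x hx => hx)
  have h₂ : 0 < ∫ y, y ^ 2 ∂ν :=
    (integral_pos_iff_support_of_nonneg_ae (Eventually.of_forall fun x => sq_nonneg x)
      (GRG.integrable_sq_of_pow_four h4)).2 (hsupp _ fun x hx => by positivity)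
  obtain ⟨C, hC0, hC⟩ := GRG.exists_abs_condExpect_sub_le hk h₁ h₂
  obtain ⟨C', hC'⟩ := GRG.exists_integral_errorBound_le k h4
  refine IsBigO.of_bound (C * C') (eventually_atTop.2 ⟨1, fun n hn => ?_⟩)
  obtain ⟨hint, hle⟩ := hC' n hn
  set r := Real.toNNReal (((∫ y, y ^ 2 ∂ν) / ∫ y, y ∂ν) ^ k / (2 * (k : ℝ))) with hr
  have hmap : (P n).map (fun ω i => X n i ω) = Measure.pi fun _ => ν := by
    rw [(hindep n).map_fun_eq_pi_map fun i => (hident n i).aemeasurable_fst]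
    congr 1
    ext1 i
    exact (hident n i).map_eq
  have hXm : AEMeasurable (fun ω i => X n i ω) (P n) :=
    (measurable_pi_iff.2 (hG n).measurable_weight).aemeasurable
  have hpipos : ∀ᵐ x ∂(Measure.pi fun _ : Fin n => ν), ∀ i, 0 < x i :=
    ae_all_iff.2 fun i => Measure.tendsto_eval_ae_ae.eventually hνpos
  have hbound : ∀ h : ℕ → ℝ, (∀ m, |h m| ≤ 1) →
      |(∫ m, h m ∂((P n).map fun ω => GRG.numCycles k (G n ω))) - ∫ m, h m ∂poissonMeasure r|
        ≤ C * C' * (n : ℝ) ^ (-(1 / 2) : ℝ) := by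
    intro h hh
    have hmeas := GRG.measurable_condExpect (n := n) (k := k) h
    have hbd : Integrable (fun x : Fin n → ℝ => GRG.condExpect k h x)
        (Measure.pi fun _ => ν) :=
      Integrable.of_bound hmeas.aestronglyMeasurable 1
        (hpipos.mono fun x hx => GRG.abs_condExpect_le hx hh)
    rw [GRG.integral_map_numCycles (hG n),
      ← integral_map (f := fun x : Fin n → ℝ => GRG.condExpect k h x) hXm
        hmeas.aestronglyMeasurable, hmap]
    have e : (∫ x : Fin n → ℝ, GRG.condExpect k h x ∂(Measure.pi fun _ => ν))
          - ∫ m, h m ∂poissonMeasure r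
        = ∫ x : Fin n → ℝ, (GRG.condExpect k h x - ∫ m, h m ∂poissonMeasure r)
          ∂(Measure.pi fun _ => ν) := by
      rw [integral_sub hbd (integrable_const _)]
      simp
    rw [e, ← Real.norm_eq_abs]
    calc _ ≤ ∫ x : Fin n → ℝ, C * GRG.errorBound k (∫ y, y ∂ν) (∫ y, y ^ 2 ∂ν) x
          ∂(Measure.pi fun _ => ν) :=
          norm_integral_le_of_norm_le (hint.const_mul C)
            (hpipos.mono fun x hx => hC n hn x hx h hh)
      _ = C * ∫ x : Fin n → ℝ, GRG.errorBound k (∫ y, y ∂ν) (∫ y, y ^ 2 ∂ν) x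
          ∂(Measure.pi fun _ => ν) := integral_const_mul _ _
      _ ≤ C * (C' * (n : ℝ) ^ (-(1 / 2) : ℝ)) := mul_le_mul_of_nonneg_left hle hC0
      _ = _ := (mul_assoc _ _ _).symm
  have htv0 : 0 ≤ GRG.tvDist ((P n).map fun ω => GRG.numCycles k (G n ω)) (poissonMeasure r) := by
    refine Real.sSup_nonneg ?_
    rintro d ⟨h, -, rfl⟩
    exact abs_nonneg _
  rw [Real.norm_of_nonneg htv0, Real.norm_of_nonneg (by positivity)]
  refine Real.sSup_le ?_ ((abs_nonneg _).trans (hbound 0 (by simp)))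
  rintro d ⟨h, hlub, rfl⟩
  exact hbound h fun m => hlub.1 ⟨m, rfl⟩
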